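/- A \emph{network} consists of a finite multigraph $G=(N,E)$, a set $T\subseteq N$ of terminals and a demand graph $(T,S)$. It is \emph{Eulerian} if every inner node (node in $N\setminus T$) has even degree. Let $\mathcal K$ be the set of anticliques (inclusion-maximal stable sets) of $(T,S)$. The Eulerian network $(G,T,\mathcal K)$ is a \emph{K-network} if any three distinct pairwise intersecting $A,B,C\in\mathcal K$ satisfy $A\cap B=A\cap C=B\cap C$. A $T$-path is a path in $G$ (traversing no edge twice) with two distinct ends in $T$. A fractional $T$-flow is a function $f\ge 0$ on the $T$-paths such that, for all nodes $x,y$, $\sum_P f(P)I(P,(x,y))\le c(x,y)$, where $c(x,y)$ is the number of $(x,y)$-edges of $G$ and $I(P,(x,y))$ is the number of those traversed by $P$. Let $\omega(u,v)$ be $1$ if $(u,v)\in S$, $\tfrac12$ if $\{u,v\}$ is contained in exactly one member of $\mathcal K$, and $0$ otherwise. The $W$-problem is to maximize $\Theta(f)=\sum_{\{u,v\}}\omega(u,v)f[u,v]$ over all fractional $T$-flows $f$, where $f[u,v]$ is the total weight of the paths with ends $u,v$; its maximum is denoted by $\theta(G,T,\mathcal K)$. A \emph{split} of an inner node $x$ removes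 $x$ and links its neighbours by $d(x)/2$ new edges (not counting loops at $x$, if any) so that the degrees of all remaining nodes are preserved (loops count twice in degrees). \textbf{Corollary.} For every Eulerian K-network $(G,T,\mathcal K)$, the maximum $\theta(G,T,\mathcal K)$ exists and $2\,\theta(G,T,\mathcal K)$ is a nonnegative integer. Moreover, every network $(G',T,\mathcal K)$ obtained from it by a split of an inner node is again an Eulerian K-network, and $$\theta(G',T,\mathcal K)=\theta(G,T,\mathcal K)-\frac k2\quad\text{for some } k\in\mathbb N\cup\{0\}.$$ -/

import Mathlib

open scoped Graph

namespace PathPacking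

noncomputable section

/-! ### Multigraphs

Multigraphs are Mathlib's `Graph α β`; parallel edges and loops are allowed. -/

/-- `c(x, y)`: the number of `(x, y)`-edges of `G`. -/
def edgeCount {α β : Type*} (G : Graph α β) (x y : α) : ℕ :=
  {e | G.IsLink e x y}.ncard

/-- The degree of a node: the number of incident edges, loops counted twice. -/
def degree {α β : Type*} (G : Graph α β) (x : α) : ℕ :=
  (G.incidenceSet x).ncard + (G.loopSet x).ncard

/-- `IsWalk G u es v`: the edge sequence `es` is traversed by a walk of `G` from `u` to `v`. -/
inductive IsWalk {α β : Type*} (G : Graph α β) : α → List β → α → Prop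
  | nil {x : α} (hx : x ∈ V(G)) : IsWalk G x [] x
  | cons {x y z : α} {e : β} {es : List β} (he : G.IsLink e x y) (hes : IsWalk G y es z) :
      IsWalk G x (e :: es) z

/-- A `T`-path: an unclosed path of `G` (no edge is traversed twice) with both ends in `T`.
It may pass through further terminals. -/
structure TPath {α β : Type*} (G : Graph α β) (T : Set α) where
  source : T
  target : T
  edges : List β
  unclosed : source ≠ target
  isWalk : IsWalk G source.1 edges target.1
  nodup : edges.Nodup

/-- `I(P, (x, y))`: the number of `(x, y)`-edges of `G` traversed by `P`. -/
def TPath.traversals {α β : Type*} {G : Graph α β} {T : Set α} (P : TPath G T) (x y : α) : ℕ :=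
  {e | e ∈ P.edges ∧ G.IsLink e x y}.ncard

/-- A fractional `T`-flow: a non-negative weight function on the `T`-paths which satisfies the
edge capacity constraints. (A finite network has only finitely many `T`-paths, so finite support
is no restriction.) -/
structure IsFractionalFlow {α β : Type*} (G : Graph α β) (T : Set α) (f : TPath G T →₀ ℝ) :
    Prop where
  nonneg : ∀ P, 0 ≤ f P
  capacity : ∀ x ∈ V(G), ∀ y ∈ V(G),
    (f.sum fun P w => w * (P.traversals x y : ℝ)) ≤ (edgeCount G x y : ℝ)

/-! ### Demand graphs and the weak problem -/

/-- The anticliques (inclusion-maximal stable sets) of a demand graph. -/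
def anticliques {ι : Type*} (S : SimpleGraph ι) : Set (Set ι) :=
  {A | Maximal (fun B : Set ι => S.IsIndepSet B) A}

/-- Any three distinct pairwise intersecting members `A`, `B`, `C` satisfy
`A ∩ B = A ∩ C = B ∩ C`. -/
def IsKClutter {ι : Type*} (K : Set (Set ι)) : Prop :=
  ∀ A ∈ K, ∀ B ∈ K, ∀ C ∈ K, A ≠ B → A ≠ C → B ≠ C →
    (A ∩ B).Nonempty → (A ∩ C).Nonempty → (B ∩ C).Nonempty →
      A ∩ B = A ∩ C ∧ A ∩ C = B ∩ C

open Classical in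
/-- The reward function of the weak problem: `1` on demand pairs, `1 / 2` on pairs covered by
exactly one anticlique, `0` on the other pairs. -/
def weakReward {ι : Type*} (S : SimpleGraph ι) (s t : ι) : ℝ :=
  if S.Adj s t then 1
  else if ∃! A : Set ι, A ∈ anticliques S ∧ s ∈ A ∧ t ∈ A then 1 / 2
  else 0

/-- An Eulerian K-network `(G, T, 𝒦)`: a finite multigraph `G`, a set `T` of terminals, all inner
nodes (non-terminals) of even degree, and a demand graph `S` on `T` whose anticlique clutter `𝒦`
is a K-clutter. -/
structure IsKNetwork {α β : Type*} (G : Graph α β) (T : Set α) (S : SimpleGraph T) : Prop where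
  finite_vertexSet : V(G).Finite
  finite_edgeSet : E(G).Finite
  terminals_subset : T ⊆ V(G)
  even_degree : ∀ x ∈ V(G) \ T, Even (degree G x)
  isKClutter : IsKClutter (anticliques S)

/-- `Θ(f)`: the total weak reward of `f`. Every path is counted once in `f[u, v]` for the unordered
pair `{u, v}` of its ends, so this is the sum of `ω(u, v) f[u, v]` over unordered pairs. -/
def weakValue {α β : Type*} {G : Graph α β} {T : Set α} (S : SimpleGraph T)
    (f : TPath G T →₀ ℝ) : ℝ :=
  f.sum fun P w => weakReward S P.source P.target * w

/-- The values of the fractional `T`-flows in the `W`-problem. -/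
def weakValues {α β : Type*} (G : Graph α β) (T : Set α) (S : SimpleGraph T) : Set ℝ :=
  {r | ∃ f : TPath G T →₀ ℝ, IsFractionalFlow G T f ∧ weakValue S f = r}

/-- `θ(G, T, 𝒦)`: the optimum of the `W`-problem. -/
def theta {α β : Type*} (G : Graph α β) (T : Set α) (S : SimpleGraph T) : ℝ :=
  sSup (weakValues G T S)

/-! ### Splits -/

open Classical in
/-- `G'` arises from the finite multigraph `G` by a split of the node `x`: `x` is removed with its
edges, and neighbours of `x` are linked by new edges so that all remaining nodes keep their degree.
The multiset `F` lists the ends of the new edges. Their number is `d(x) / 2`, where loops at `x`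
(if any) are discarded. A new edge may be parallel to other edges, or a loop, if two parallel edges
at `x` are joined to each other. -/
def IsSplit {α β γ : Type*} (G : Graph α β) (x : α) (G' : Graph α γ) : Prop :=
  V(G') = V(G) \ {x} ∧ E(G').Finite ∧
    ∃ F : Multiset (Sym2 α),
      (∀ p ∈ F, ∀ y ∈ p, y ≠ x ∧ G.Adj x y) ∧
      2 * F.card + 2 * edgeCount G x x = degree G x ∧
      (∀ y z : α, y ≠ x → z ≠ x →
        edgeCount G' y z = edgeCount G y z + F.count s(y, z)) ∧
      ∀ y ∈ V(G'), degree G' y = degree G y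

end

end PathPacking

namespace PathPacking

noncomputable section

/-!
By linear programming duality, `θ` is the least total of nonnegative edge lengths for which the
length of every path between two terminals is at least its reward. For a K-clutter of anticliques,
four times the reward is the distance of terminals in a bipartite metric, the frame: the anticliques
are its lines, adjacent to a common center and to the terminals that lie on them. Optimal edge
lengths, scaled by four, place the nodes in the folder complex spanned by the frame by their
distances to the terminals, and rounding all nodes at a common random threshold maps them to
vertices of the frame so that no edge gets longer in the mean. Hence `8 * θ` is twice the total
length of the edges under some map of the nodes to the frame that fixes the terminals. This number
is divisible by `4`, since the frame is bipartite and the inner nodes have even degree, and by the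
triangle inequality a split does not increase it.
-/

section ClassDistance

variable {ι : Type*} {S : SimpleGraph ι}

lemma exists_anticlique_of_not_adj [Finite ι] {s t : ι} (h : ¬ S.Adj s t) :
    ∃ A ∈ anticliques S, s ∈ A ∧ t ∈ A := by
  have hst : S.IsIndepSet {s, t} :=
    Set.pairwise_pair.2 fun _ => ⟨h, fun h' => h h'.symm⟩
  obtain ⟨A, hstA, hA⟩ := (Set.toFinite {B : Set ι | S.IsIndepSet B}).exists_le_maximal hst
  exact ⟨A, hA, hstA (by simp), hstA (by simp)⟩

lemma not_adj_of_mem_anticlique {A : Set ι} (hA : A ∈ anticliques S) {s t : ι} (hs : s ∈ A)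
    (ht : t ∈ A) : ¬ S.Adj s t :=
  fun h => hA.1 hs ht h.ne h

open Classical in
/-- Four times the weak reward of a pair of terminals, set to `0` on the diagonal. Terminals at
distance `0` lie on the same anticliques of a K-clutter: they form a class. -/
def classDist (S : SimpleGraph ι) (s t : ι) : ℕ :=
  if s = t then 0
  else if S.Adj s t then 4
  else if ∃! A : Set ι, A ∈ anticliques S ∧ s ∈ A ∧ t ∈ A then 2
  else 0

lemma classDist_self (s : ι) : classDist S s s = 0 := by simp [classDist]

lemma classDist_eq_four_mul_weakReward {s t : ι} (h : s ≠ t) :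
    (classDist S s t : ℝ) = 4 * weakReward S s t := by
  unfold classDist weakReward
  rw [if_neg h]
  split_ifs <;> norm_num

open Classical in
lemma classDist_comm (s t : ι) : classDist S s t = classDist S t s := by
  have hswap (A : Set ι) : A ∈ anticliques S ∧ s ∈ A ∧ t ∈ A ↔ A ∈ anticliques S ∧ t ∈ A ∧ s ∈ A :=
    and_congr_right' and_comm
  exact if_congr eq_comm rfl
    (if_congr (S.adj_comm s t) rfl (if_congr (existsUnique_congr hswap) rfl rfl))

lemma classDist_cases (s t : ι) :
    classDist S s t = 0 ∨ classDist S s t = 2 ∨ classDist S s t = 4 := by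
  unfold classDist
  split_ifs <;> simp

lemma classDist_le_four (s t : ι) : classDist S s t ≤ 4 := by
  have := classDist_cases (S := S) s t
  omega

lemma classDist_le_two {A : Set ι} (hA : A ∈ anticliques S) {s t : ι} (hs : s ∈ A)
    (ht : t ∈ A) : classDist S s t ≤ 2 := by
  unfold classDist
  rw [if_neg (not_adj_of_mem_anticlique hA hs ht)]
  split_ifs <;> simp

lemma exists_anticlique_of_classDist_lt [Finite ι] {s t : ι} (h : classDist S s t < 4) :
    ∃ A ∈ anticliques S, s ∈ A ∧ t ∈ A := by
  apply exists_anticlique_of_not_adj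
  intro hadj
  simp [classDist, hadj, hadj.ne] at h

lemma eq_of_classDist_ne_zero {s t : ι} (h : classDist S s t ≠ 0) {A B : Set ι}
    (hA : A ∈ anticliques S) (hB : B ∈ anticliques S) (hsA : s ∈ A) (htA : t ∈ A)
    (hsB : s ∈ B) (htB : t ∈ B) : A = B := by
  unfold classDist at h
  rw [if_neg (not_adj_of_mem_anticlique hA hsA htA)] at h
  split_ifs at h with _ hunique
  · contradiction
  · exact hunique.unique ⟨hA, hsA, htA⟩ ⟨hB, hsB, htB⟩
  · contradiction

lemma exists_two_anticliques_of_classDist_eq_zero [Finite ι] {s t : ι} (hst : s ≠ t)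
    (h : classDist S s t = 0) :
    ∃ A ∈ anticliques S, ∃ B ∈ anticliques S, A ≠ B ∧ s ∈ A ∧ t ∈ A ∧ s ∈ B ∧ t ∈ B := by
  obtain ⟨A, hA, hsA, htA⟩ := exists_anticlique_of_classDist_lt (h.trans_lt (by norm_num))
  by_contra! hcon
  have hunique : ∃! A : Set ι, A ∈ anticliques S ∧ s ∈ A ∧ t ∈ A := by
    refine ⟨A, ⟨hA, hsA, htA⟩, fun B hB => ?_⟩
    by_contra hne
    exact hcon A hA B hB.1 (Ne.symm hne) hsA htA hB.2.1 hB.2.2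
  simp [classDist, hst, not_adj_of_mem_anticlique hA hsA htA, hunique] at h

lemma mem_of_classDist_eq_zero [Finite ι] (hK : IsKClutter (anticliques S)) {s t : ι}
    (h : classDist S s t = 0) {C : Set ι} (hC : C ∈ anticliques S) (hs : s ∈ C) : t ∈ C := by
  by_cases hst : s = t
  · exact hst ▸ hs
  obtain ⟨A, hA, B, hB, hAB, hsA, htA, hsB, htB⟩ :=
    exists_two_anticliques_of_classDist_eq_zero hst h
  by_cases hAC : A = C
  · exact hAC ▸ htA
  by_cases hBC : B = C
  · exact hBC ▸ htB
  have hABC := (hK A hA B hB C hC hAB hAC hBC ⟨s, hsA, hsB⟩ ⟨s, hsA, hs⟩ ⟨s, hsB, hs⟩).1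
  exact (hABC ▸ (⟨htA, htB⟩ : t ∈ A ∩ B) : t ∈ A ∩ C).2

lemma mem_iff_of_classDist_eq_zero [Finite ι] (hK : IsKClutter (anticliques S)) {s t : ι}
    (h : classDist S s t = 0) {C : Set ι} (hC : C ∈ anticliques S) : s ∈ C ↔ t ∈ C :=
  ⟨mem_of_classDist_eq_zero hK h hC,
    mem_of_classDist_eq_zero hK ((classDist_comm t s).trans h) hC⟩

lemma classDist_eq_four [Finite ι] (hK : IsKClutter (anticliques S)) {s t u : ι} {A B : Set ι}
    (hA : A ∈ anticliques S) (hB : B ∈ anticliques S) (hAB : A ≠ B) (hsA : s ∈ A) (htA : t ∈ A)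
    (htB : t ∈ B) (huB : u ∈ B) (hst : classDist S s t ≠ 0) (htu : classDist S t u ≠ 0) :
    classDist S s u = 4 := by
  by_contra hne
  obtain ⟨C, hC, hsC, huC⟩ :=
    exists_anticlique_of_classDist_lt (lt_of_le_of_ne (classDist_le_four s u) hne)
  have hAC : A ≠ C := by
    rintro rfl
    exact hAB (eq_of_classDist_ne_zero htu hA hB htA huC htB huB)
  have hBC : B ≠ C := by
    rintro rfl
    exact hAB (eq_of_classDist_ne_zero hst hA hB hsA htA hsC htB)
  have hABC := (hK A hA B hB C hC hAB hAC hBC ⟨t, htA, htB⟩ ⟨s, hsA, hsC⟩ ⟨u, huB, huC⟩).1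
  have htC : t ∈ C := (hABC ▸ (⟨htA, htB⟩ : t ∈ A ∩ B) : t ∈ A ∩ C).2
  exact hAC (eq_of_classDist_ne_zero hst hA hC hsA htA hsC htC)

lemma classDist_le_of_classDist_eq_zero [Finite ι] (hK : IsKClutter (anticliques S)) {s t : ι}
    (h : classDist S s t = 0) (u : ι) : classDist S s u ≤ classDist S t u := by
  have hle_four := classDist_le_four (S := S) s u
  rcases classDist_cases (S := S) t u with h0 | h2 | h4
  · by_contra! hlt
    by_cases htu : t = u
    · subst htu
      omega
    obtain ⟨A, hA, B, hB, hAB, htA, huA, htB, huB⟩ :=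
      exists_two_anticliques_of_classDist_eq_zero htu h0
    have hsA := (mem_iff_of_classDist_eq_zero hK h hA).2 htA
    have hsB := (mem_iff_of_classDist_eq_zero hK h hB).2 htB
    exact hAB (eq_of_classDist_ne_zero hlt.ne_bot hA hB hsA huA hsB huB)
  · obtain ⟨A, hA, htA, huA⟩ := exists_anticlique_of_classDist_lt (h2.trans_lt (by norm_num))
    exact (classDist_le_two hA ((mem_iff_of_classDist_eq_zero hK h hA).2 htA) huA).trans h2.ge
  · omega

lemma classDist_triangle [Finite ι] (hK : IsKClutter (anticliques S)) (s t u : ι) :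
    classDist S s u ≤ classDist S s t + classDist S t u := by
  rcases eq_or_ne (classDist S s t) 0 with h | h
  · have := classDist_le_of_classDist_eq_zero hK h u
    omega
  rcases eq_or_ne (classDist S t u) 0 with h' | h'
  · have := classDist_le_of_classDist_eq_zero hK ((classDist_comm u t).trans h') s
    rw [classDist_comm u s, classDist_comm t s] at this
    omega
  · have h1 := classDist_cases (S := S) s t
    have h2 := classDist_cases (S := S) t u
    have h3 := classDist_le_four (S := S) s u
    omega

end ClassDistance

section Frame

variable {ι : Type*} {S : SimpleGraph ι}

/-- The vertices of the frame of a demand graph: a center, the anticliques (the lines), and the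
terminals. -/
inductive FrameVertex (S : SimpleGraph ι) : Type _
  | center : FrameVertex S
  | line (A : anticliques S) : FrameVertex S
  | terminal (t : ι) : FrameVertex S

open Classical in
/-- The distances in the frame, where each line is adjacent to the center and to the terminals that
lie on it. Terminals on the same lines count as one vertex, as they do in `classDist`. -/
def frameDist : FrameVertex S → FrameVertex S → ℕ
  | .center, .center => 0
  | .center, .line _ => 1
  | .center, .terminal _ => 2
  | .line _, .center => 1
  | .line A, .line B => if A = B then 0 else 2
  | .line A, .terminal t => if t ∈ A.1 then 1 else 3
  | .terminal _, .center => 2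
  | .terminal t, .line A => if t ∈ A.1 then 1 else 3
  | .terminal s, .terminal t => classDist S s t

lemma frameDist_self (p : FrameVertex S) : frameDist p p = 0 := by
  cases p <;> simp [frameDist, classDist_self]

lemma frameDist_comm (p q : FrameVertex S) : frameDist p q = frameDist q p := by
  cases p <;> cases q <;> simp [frameDist, eq_comm, classDist_comm]

lemma frameDist_triangle [Finite ι] (hK : IsKClutter (anticliques S)) (p q r : FrameVertex S) :
    frameDist p r ≤ frameDist p q + frameDist q r := by
  have hcases := classDist_cases (S := S)
  have hmem (s t : ι) (A : anticliques S) (h : classDist S s t = 0) : s ∈ A.1 ↔ t ∈ A.1 :=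
    mem_iff_of_classDist_eq_zero hK h A.2
  have hline (s t : ι) (A : anticliques S) (hs : s ∈ A.1) (ht : t ∈ A.1) : classDist S s t ≤ 2 :=
    classDist_le_two A.2 hs ht
  rcases p with _ | A | s <;> rcases q with _ | B | t <;> rcases r with _ | C | u <;>
    simp only [frameDist]
  case terminal.terminal.terminal => exact classDist_triangle hK s t u
  all_goals grind

/-- The bipartition of the frame: `1` on the lines, `0` on the center and the terminals. -/
def frameParity : FrameVertex S → ℕ
  | .center => 0
  | .line _ => 1
  | .terminal _ => 0

lemma frameDist_modEq (p q : FrameVertex S) :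
    frameDist p q ≡ frameParity p + frameParity q [MOD 2] := by
  have hcases := classDist_cases (S := S)
  rcases p with _ | A | s <;> rcases q with _ | B | t <;>
    simp only [frameDist, frameParity, Nat.ModEq] <;> grind

/-- The pseudometric space of nodes that are mapped to the frame by `φ`. -/
def frameMetric [Finite ι] (hK : IsKClutter (anticliques S)) {α : Type*}
    (φ : α → FrameVertex S) : PseudoMetric α ℕ where
  toFun x y := frameDist (φ x) (φ y)
  refl' x := frameDist_self (φ x)
  symm' x y := frameDist_comm (φ x) (φ y)
  triangle' x y z := frameDist_triangle hK (φ x) (φ y) (φ z)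

lemma frameMetric_apply [Finite ι] (hK : IsKClutter (anticliques S)) {α : Type*}
    (φ : α → FrameVertex S) (x y : α) : frameMetric hK φ x y = frameDist (φ x) (φ y) := rfl

end Frame

section EdgeSum

variable {α β R : Type*} {G : Graph α β} {x y : α} {e : β}

/-- The sum of `g x y` over the ordered pairs `(x, y)` of ends of the edge `e`; a loop has just one
such pair. -/
def edgeSum [AddCommMonoid R] (G : Graph α β) (g : α → α → R) (e : β) : R :=
  ∑ᶠ p ∈ {p : α × α | G.IsLink e p.1 p.2}, g p.1 p.2

/-- The total of `edgeSum G g` over the edges of `G`: for a metric `g`, twice the total length of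
the edges. -/
def graphSum [AddCommMonoid R] (G : Graph α β) (g : α → α → R) : R :=
  ∑ᶠ e ∈ E(G), edgeSum G g e

lemma setOf_ends_eq_pair (he : G.IsLink e x y) :
    {p : α × α | G.IsLink e p.1 p.2} = {(x, y), (y, x)} := by
  ext ⟨u, v⟩
  simp only [Set.mem_ofPred_eq, he.isLink_iff, Set.mem_insert_iff, Set.mem_singleton_iff,
    Prod.mk.injEq]
  tauto

lemma edgeSum_of_isLink_self [AddCommMonoid R] (g : α → α → R) (he : G.IsLink e x x) :
    edgeSum G g e = g x x := by
  rw [edgeSum, setOf_ends_eq_pair he, Set.pair_eq_singleton, finsum_mem_singleton]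

lemma edgeSum_of_isLink_of_ne [AddCommMonoid R] (g : α → α → R) (he : G.IsLink e x y)
    (hxy : x ≠ y) : edgeSum G g e = g x y + g y x := by
  rw [edgeSum, setOf_ends_eq_pair he, finsum_mem_pair (by simp [hxy])]

lemma edgeSum_nonneg {g : α → α → ℝ} (hg : ∀ x y, 0 ≤ g x y) (e : β) : 0 ≤ edgeSum G g e :=
  finsum_nonneg fun p => finsum_nonneg fun _ => hg p.1 p.2

lemma edgeSum_pseudoMetric (d : PseudoMetric α ℕ) (he : G.IsLink e x y) :
    edgeSum G d e = 2 * d x y := by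
  by_cases hxy : x = y
  · subst hxy
    rw [edgeSum_of_isLink_self _ he, d.refl, mul_zero]
  · rw [edgeSum_of_isLink_of_ne _ he hxy, d.symm y x, two_mul]

lemma edgeSum_eq_sum [AddCommMonoid R] {V : Finset α} (hV : V = V(G)) (g : α → α → R) (e : β)
    [∀ x y, Decidable (G.IsLink e x y)] :
    edgeSum G g e = ∑ x ∈ V, ∑ y ∈ V, if G.IsLink e x y then g x y else 0 := by
  have hends : {p : α × α | G.IsLink e p.1 p.2} =
      ((V ×ˢ V).filter fun p => G.IsLink e p.1 p.2) := by
    ext p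
    have hmem (h : G.IsLink e p.1 p.2) : p.1 ∈ V ∧ p.2 ∈ V := by
      simpa only [← Finset.mem_coe, hV] using ⟨h.left_mem, h.right_mem⟩
    simpa using hmem
  rw [edgeSum, hends, finsum_mem_coe_finset, Finset.sum_filter, Finset.sum_product]

lemma graphSum_eq_sum [AddCommMonoid R] {E : Finset β} (hE : E = E(G)) (g : α → α → R) :
    graphSum G g = ∑ e ∈ E, edgeSum G g e := by
  rw [graphSum, ← hE, finsum_mem_coe_finset]

lemma sum_edgeSum_eq_sum_card_mul [CommSemiring R] {V : Finset α} (hV : V = V(G)) (F : Finset β)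
    (g : α → α → R) :
    ∑ e ∈ F, edgeSum G g e =
      ∑ x ∈ V, ∑ y ∈ V, ({e | e ∈ F ∧ G.IsLink e x y}.ncard : R) * g x y := by
  classical
  have hcard (x y : α) : ({e | e ∈ F ∧ G.IsLink e x y}.ncard : R) * g x y =
      ∑ e ∈ F, if G.IsLink e x y then g x y else 0 := by
    rw [← Finset.coe_filter, Set.ncard_coe_finset, ← nsmul_eq_mul, ← Finset.sum_const,
      Finset.sum_filter]
  simp only [edgeSum_eq_sum hV, hcard]
  rw [Finset.sum_comm]
  exact Finset.sum_congr rfl fun x _ => Finset.sum_comm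

lemma graphSum_eq_sum_edgeCount_mul [CommSemiring R] {V : Finset α} (hV : V = V(G))
    (hE : E(G).Finite) (g : α → α → R) :
    graphSum G g = ∑ x ∈ V, ∑ y ∈ V, (edgeCount G x y : R) * g x y := by
  have hlink (x y : α) : {e | e ∈ hE.toFinset ∧ G.IsLink e x y} = {e | G.IsLink e x y} := by
    ext e
    simpa using fun h : G.IsLink e x y => h.edge_mem
  rw [graphSum_eq_sum hE.coe_toFinset, sum_edgeSum_eq_sum_card_mul hV]
  simp only [hlink, edgeCount]

lemma graphSum_natCast (hV : V(G).Finite) (hE : E(G).Finite) (g : α → α → ℕ) :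
    graphSum G (fun x y => (g x y : ℝ)) = (graphSum G g : ℕ) := by
  simp only [graphSum_eq_sum_edgeCount_mul hV.coe_toFinset hE]
  push_cast
  rfl

lemma edgeSum_natCast (g : α → α → ℕ) (he : e ∈ E(G)) :
    edgeSum G (fun x y => (g x y : ℝ)) e = (edgeSum G g e : ℕ) := by
  obtain ⟨x, y, hxy⟩ := G.exists_isLink_of_mem_edgeSet he
  by_cases hne : x = y
  · subst hne
    simp only [edgeSum_of_isLink_self _ hxy]
  · simp only [edgeSum_of_isLink_of_ne _ hxy hne, Nat.cast_add]

end EdgeSum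

section Degree

variable {α β : Type*} {G : Graph α β} {V : Finset α}

lemma edgeCount_comm (x y : α) : edgeCount G x y = edgeCount G y x := by
  simp only [edgeCount, G.isLink_comm (x := x)]

lemma degree_eq_sum_edgeCount (hV : V = V(G)) (hE : E(G).Finite) (x : α) :
    degree G x = ∑ y ∈ V, edgeCount G x y + edgeCount G x x := by
  classical
  have hincidence : G.incidenceSet x = ⋃ y ∈ (V : Set α), {e | G.IsLink e x y} := by
    ext e
    have hmem (y : α) (h : G.IsLink e x y) : y ∈ V := by
      rw [← Finset.mem_coe, hV]
      exact h.right_mem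
    simp only [Graph.mem_incidenceSet, Graph.Inc, Set.mem_iUnion, Set.mem_ofPred_eq, exists_prop,
      Finset.mem_coe]
    exact ⟨fun ⟨y, h⟩ => ⟨y, hmem y h, h⟩, fun ⟨y, _, h⟩ => ⟨y, h⟩⟩
  have hdisjoint : (V : Set α).PairwiseDisjoint fun y => {e | G.IsLink e x y} :=
    fun y _ z _ hyz => Set.disjoint_left.2 fun e hy hz => hyz (hy.right_unique hz)
  have hfinite (y : α) : {e | G.IsLink e x y}.Finite := hE.subset fun e h => h.edge_mem
  rw [degree, hincidence, V.finite_toSet.ncard_biUnion (fun y _ => hfinite y) hdisjoint,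
    finsum_mem_coe_finset]
  rfl

lemma edgeSum_handshake (h : α → ℕ) {e : β} {x y : α} (he : G.IsLink e x y) [DecidableEq α] :
    edgeSum G (fun u v => h u + if u = v then h u else 0) e = h x + h y := by
  by_cases hxy : x = y
  · subst hxy
    simp [edgeSum_of_isLink_self _ he]
  · simp [edgeSum_of_isLink_of_ne _ he hxy, hxy, Ne.symm hxy]

lemma sum_mul_degree [DecidableEq α] (hV : V = V(G)) (hE : E(G).Finite) (h : α → ℕ) :
    ∑ x ∈ V, h x * degree G x =
      graphSum G fun x y => h x + if x = y then h x else 0 := by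
  rw [graphSum_eq_sum_edgeCount_mul hV hE]
  refine Finset.sum_congr rfl fun x hx => ?_
  rw [degree_eq_sum_edgeCount hV hE, mul_comm, add_mul, Finset.sum_mul]
  simp only [Nat.cast_id, mul_add, Finset.sum_add_distrib, mul_ite, mul_zero, Finset.sum_ite_eq, hx,
    if_true]

/-- An edge contributes twice its length, and half of this contribution has the parity of the sum of
`h` over the ends of the edge; the handshake lemma turns these sums into degrees. -/
lemma four_dvd_graphSum (hV : V(G).Finite) (hE : E(G).Finite) (d : PseudoMetric α ℕ) (h : α → ℕ)
    (hd : ∀ x y, d x y ≡ h x + h y [MOD 2]) (heven : ∀ x ∈ V(G), Even (h x * degree G x)) :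
    4 ∣ graphSum G d := by
  classical
  let ends (x y : α) : ℕ := h x + if x = y then h x else 0
  have hedge : ∀ e ∈ hE.toFinset, edgeSum G d e ≡ 2 * edgeSum G ends e [MOD 4] := by
    intro e he
    obtain ⟨x, y, hxy⟩ := G.exists_isLink_of_mem_edgeSet (hE.mem_toFinset.1 he)
    rw [edgeSum_pseudoMetric d hxy, edgeSum_handshake h hxy]
    exact (hd x y).mul_left' 2
  have hsum : graphSum G d ≡ 2 * graphSum G ends [MOD 4] := by
    simp only [graphSum_eq_sum hE.coe_toFinset, Finset.mul_sum]
    exact Nat.ModEq.sum hedge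
  have htwo : 2 ∣ graphSum G ends := by
    rw [← sum_mul_degree hV.coe_toFinset hE h]
    exact Finset.dvd_sum fun x hx => (heven x (hV.mem_toFinset.1 hx)).two_dvd
  exact (hsum.dvd_iff (dvd_refl 4)).2 (mul_dvd_mul_left 2 htwo)

end Degree

section Split

variable {α β γ : Type*} {G : Graph α β} {G' : Graph α γ} {V : Finset α} {x : α}

lemma sum_sum_eq_sum_erase_add [DecidableEq α] (hx : x ∈ V) {c : α → α → ℕ}
    (hcomm : ∀ y z, c y z = c z y) (hself : c x x = 0) :
    ∑ y ∈ V, ∑ z ∈ V, c y z =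
      ∑ y ∈ V.erase x, ∑ z ∈ V.erase x, c y z + 2 * ∑ y ∈ V.erase x, c y x := by
  simp only [← Finset.sum_erase_add V _ hx, Finset.sum_add_distrib, hself, hcomm x]
  ring

lemma sum_mul_dist_le_two_mul (d : PseudoMetric α ℕ) (W : Finset α) {m : α → α → ℕ}
    (hm : ∀ y z, m y z = m z y) (x : α) :
    ∑ y ∈ W, ∑ z ∈ W, m y z * d y z ≤ 2 * ∑ y ∈ W, (∑ z ∈ W, m y z) * d y x :=
  calc ∑ y ∈ W, ∑ z ∈ W, m y z * d y z
      ≤ ∑ y ∈ W, ∑ z ∈ W, (m y z * d y x + m z y * d z x) := by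
        refine Finset.sum_le_sum fun y _ => Finset.sum_le_sum fun z _ => ?_
        rw [hm z y, ← mul_add, d.symm z x]
        exact Nat.mul_le_mul_left _ (d.triangle y x z)
    _ = 2 * ∑ y ∈ W, (∑ z ∈ W, m y z) * d y x := by
        simp only [Finset.sum_add_distrib, Finset.sum_mul]
        rw [Finset.sum_comm (f := fun y z => m z y * d z x), two_mul]

lemma sum_le_edgeCount_of_degree_eq [DecidableEq α] (hV : V = V(G)) (hV' : V.erase x = V(G'))
    (hE : E(G).Finite) (hE' : E(G').Finite) (hx : x ∈ V) {y : α} (hy : y ≠ x) {m : α → ℕ}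
    (hcount : ∀ z, z ≠ x → edgeCount G' y z = edgeCount G y z + m z)
    (hdegree : degree G' y = degree G y) :
    ∑ z ∈ V.erase x, m z ≤ edgeCount G y x := by
  rw [degree_eq_sum_edgeCount hV' hE', degree_eq_sum_edgeCount hV hE, hcount y hy,
    Finset.sum_congr rfl fun z hz => hcount z (Finset.ne_of_mem_erase hz),
    Finset.sum_add_distrib, ← Finset.sum_erase_add V _ hx] at hdegree
  omega

lemma graphSum_split_le (hV : V(G).Finite) (hE : E(G).Finite) (hx : x ∈ V(G))
    (h : IsSplit G x G') (d : PseudoMetric α ℕ) : graphSum G' d ≤ graphSum G d := by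
  classical
  obtain ⟨hV', hE', F, -, -, hcount, hdegree⟩ := h
  set V := hV.toFinset
  set W := V.erase x
  have hVG : (V : Set α) = V(G) := hV.coe_toFinset
  have hWG' : (W : Set α) = V(G') := by rw [hV', ← hVG, Finset.coe_erase]
  have hxV : x ∈ V := hV.mem_toFinset.2 hx
  let m (y z : α) : ℕ := F.count s(y, z)
  have hm (y z : α) : m y z = m z y := congrArg (F.count ·) Sym2.eq_swap
  have hne {y : α} (hy : y ∈ W) : y ≠ x := Finset.ne_of_mem_erase hy
  have hnew : ∑ y ∈ W, ∑ z ∈ W, m y z * d y z ≤ 2 * ∑ y ∈ W, edgeCount G y x * d y x :=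
    (sum_mul_dist_le_two_mul d W hm x).trans <| by
      gcongr with y hy
      exact sum_le_edgeCount_of_degree_eq hVG hWG' hE hE' hxV (hne hy)
        (hcount y · (hne hy)) (hdegree y (hWG' ▸ hy))
  have hold : graphSum G d =
      ∑ y ∈ W, ∑ z ∈ W, edgeCount G y z * d y z + 2 * ∑ y ∈ W, edgeCount G y x * d y x := by
    rw [graphSum_eq_sum_edgeCount_mul hVG hE]
    exact sum_sum_eq_sum_erase_add hxV (fun y z => by rw [edgeCount_comm, d.symm])
      (by simp [d.refl])
  have hsplit : graphSum G' d =
      ∑ y ∈ W, ∑ z ∈ W, edgeCount G y z * d y z + ∑ y ∈ W, ∑ z ∈ W, m y z * d y z := by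
    simp only [graphSum_eq_sum_edgeCount_mul hWG' hE', ← Finset.sum_add_distrib, ← add_mul]
    refine Finset.sum_congr rfl fun y hy => Finset.sum_congr rfl fun z hz => ?_
    rw [hcount y z (hne hy) (hne hz), Nat.cast_id]
  omega

end Split

section LinearProgramming

variable {I J : Type*}

lemma nonneg_of_forall_le_mul {a s : ℝ} (h : ∀ w : ℝ, 0 ≤ w → s ≤ w * a) : 0 ≤ a := by
  by_contra! ha
  have hw := h ((|s| + 1) / -a) (div_nonneg (by positivity) (by linarith))
  have heq : (|s| + 1) / -a * a = -(|s| + 1) := by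
    have := ha.ne
    field_simp
  linarith [neg_abs_le s]

lemma apply_eq_sum_mul_add [Fintype I] [DecidableEq I] (F : (I → ℝ) × ℝ →L[ℝ] ℝ) (z : I → ℝ)
    (r : ℝ) : F (z, r) = ∑ i, z i * F (Pi.single i 1, 0) + r * F (0, 1) := by
  have hz : F (z, 0) = ∑ i, z i * F (Pi.single i 1, 0) := by
    have hsingle (i : I) : (Pi.single i 1 : I → ℝ) = fun j => if i = j then 1 else 0 := by
      ext j
      simp only [Pi.single_apply, eq_comm]
    simp only [hsingle]
    exact ((F : (I → ℝ) × ℝ →ₗ[ℝ] ℝ) ∘ₗ LinearMap.inl ℝ (I → ℝ) ℝ).pi_apply_eq_sum_univ z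
  have hr : F (0, r) = r * F (0, 1) := by
    rw [← smul_eq_mul, ← map_smul, Prod.smul_mk, smul_zero, smul_eq_mul, mul_one]
  rw [← hz, ← hr, ← map_add, Prod.mk_add_mk, add_zero, zero_add]

lemma exists_separating_coeffs [Fintype I] {A : J → I → ℝ} {b : J → ℝ} {c : I → ℝ} {θ : ℝ}
    (hθ : ∀ f : J →₀ ℝ, (∀ j, 0 ≤ f j) → (∀ i, (f.sum fun j w => w * A j i) ≤ c i) →
      (f.sum fun j w => w * b j) ≤ θ) :
    ∃ (m : I → ℝ) (k : ℝ), (∀ j, 0 ≤ ∑ i, A j i * m i + b j * k) ∧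
      ∀ (z : I → ℝ) (r : ℝ), (∀ i, z i < c i) → θ < r → ∑ i, z i * m i + r * k < 0 := by
  classical
  let L : (J →₀ ℝ) →ₗ[ℝ] (I → ℝ) × ℝ := Finsupp.linearCombination ℝ fun j => (A j, b j)
  let U : Set ((I → ℝ) × ℝ) := (Set.univ.pi fun i => Set.Iio (c i)) ×ˢ Set.Ioi θ
  have hUconvex : Convex ℝ U := (convex_pi fun i _ => convex_Iio _).prod (convex_Ioi _)
  have hUopen : IsOpen U := (isOpen_set_pi Set.finite_univ fun i _ => isOpen_Iio).prod isOpen_Ioi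
  have hdisjoint : Disjoint U (L '' {f | 0 ≤ f}) := by
    rw [Set.disjoint_left]
    rintro _ ⟨hlt, hgt⟩ ⟨f, hf, rfl⟩
    simp only [L, Finsupp.linearCombination_apply, Finsupp.sum, Set.mem_pi, Prod.fst_sum,
      Prod.snd_sum, Finset.sum_apply, Prod.smul_mk, Pi.smul_apply, smul_eq_mul] at hlt hgt
    exact absurd (hθ f hf fun i => (hlt i trivial).le) (not_le.2 hgt)
  obtain ⟨F, s, hFU, hFL⟩ := geometric_hahn_banach_open hUconvex hUopen
    ((convex_Ici 0).linear_image L) hdisjoint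
  refine ⟨fun i => F (Pi.single i 1, 0), F (0, 1), fun j => ?_, fun z r hz hr => ?_⟩
  · rw [← apply_eq_sum_mul_add]
    refine nonneg_of_forall_le_mul (s := s) fun w hw => ?_
    have hray := hFL (L (Finsupp.single j w)) ⟨_, Finsupp.single_nonneg.2 hw, rfl⟩
    rwa [Finsupp.linearCombination_single, map_smul, smul_eq_mul] at hray
  · rw [← apply_eq_sum_mul_add]
    have hs : s ≤ 0 := by simpa using hFL (L 0) ⟨0, Set.self_mem_Ici, rfl⟩
    exact (hFU (z, r) ⟨fun i _ => hz i, hr⟩).trans_le hs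

lemma nonneg_of_forall_sum_mul_add_neg [Fintype I] {c m : I → ℝ} {k θ : ℝ} (hc : ∀ i, 0 < c i)
    (hneg : ∀ (z : I → ℝ) (r : ℝ), (∀ i, z i < c i) → θ < r → ∑ i, z i * m i + r * k < 0)
    (i : I) : 0 ≤ m i := by
  classical
  refine nonneg_of_forall_le_mul (s := (θ + 1) * k) fun w hw => ?_
  have hlt (j : I) : Pi.single (M := fun _ => ℝ) i (-w) j < c j := by
    rcases eq_or_ne j i with rfl | hne
    · rw [Pi.single_eq_same]
      linarith [hc j]
    · simpa [hne] using hc j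
  have h := hneg _ (θ + 1) hlt (lt_add_one θ)
  simp only [Pi.single_apply, ite_mul, zero_mul, Finset.sum_ite_eq', Finset.mem_univ, if_true] at h
  linarith

lemma sum_mul_add_mul_le_zero [Fintype I] {c m : I → ℝ} {k θ : ℝ}
    (hneg : ∀ (z : I → ℝ) (r : ℝ), (∀ i, z i < c i) → θ < r → ∑ i, z i * m i + r * k < 0) :
    ∑ i, c i * m i + θ * k ≤ 0 := by
  have hlim : Filter.Tendsto (fun ε : ℝ => ∑ i, (c i - ε) * m i + (θ + ε) * k)
      (nhdsWithin 0 (Set.Ioi 0)) (nhds (∑ i, (c i - 0) * m i + (θ + 0) * k)) :=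
    (Continuous.tendsto (by fun_prop) 0).mono_left nhdsWithin_le_nhds
  simp only [sub_zero, add_zero] at hlim
  refine le_of_tendsto hlim ?_
  filter_upwards [self_mem_nhdsWithin] with ε hε
  exact (hneg _ _ (fun i => sub_lt_self _ hε) (lt_add_of_pos_right _ hε)).le

/-- The capacities are positive, so that the separating functional is not vertical; this makes up
for the index set `J` of the packing variables being infinite. -/
lemma exists_dual_of_packing_le_univ [Fintype I] {A : J → I → ℝ} {b : J → ℝ} {c : I → ℝ} {θ : ℝ}
    (hc : ∀ i, 0 < c i)
    (hθ : ∀ f : J →₀ ℝ, (∀ j, 0 ≤ f j) → (∀ i, (f.sum fun j w => w * A j i) ≤ c i) →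
      (f.sum fun j w => w * b j) ≤ θ) :
    ∃ l : I → ℝ, (∀ i, 0 ≤ l i) ∧ (∀ j, b j ≤ ∑ i, A j i * l i) ∧ ∑ i, c i * l i ≤ θ := by
  obtain ⟨m, k, hcone, hneg⟩ := exists_separating_coeffs hθ
  have hk : k < 0 := by
    have h := hneg 0 (max θ 0 + 1) hc (lt_of_le_of_lt (le_max_left θ 0) (lt_add_one _))
    simp only [Pi.zero_apply, zero_mul, Finset.sum_const_zero, zero_add] at h
    exact neg_of_mul_neg_right h (by positivity)
  have hk' : 0 < -k := neg_pos.2 hk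
  refine ⟨fun i => m i / -k,
    fun i => div_nonneg (nonneg_of_forall_sum_mul_add_neg hc hneg i) hk'.le, fun j => ?_, ?_⟩
  · simp only [← mul_div_assoc]
    rw [← Finset.sum_div, le_div_iff₀ hk']
    linarith [hcone j]
  · simp only [← mul_div_assoc]
    rw [← Finset.sum_div, div_le_iff₀ hk']
    linarith [sum_mul_add_mul_le_zero hneg]

lemma exists_dual_of_packing_le {s : Finset I} {A : J → I → ℝ} {b : J → ℝ} {c : I → ℝ} {θ : ℝ}
    (hc : ∀ i ∈ s, 0 < c i)
    (hθ : ∀ f : J →₀ ℝ, (∀ j, 0 ≤ f j) → (∀ i ∈ s, (f.sum fun j w => w * A j i) ≤ c i) →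
      (f.sum fun j w => w * b j) ≤ θ) :
    ∃ l : I → ℝ, (∀ i, 0 ≤ l i) ∧ (∀ j, b j ≤ ∑ i ∈ s, A j i * l i) ∧
      ∑ i ∈ s, c i * l i ≤ θ := by
  obtain ⟨l, hl, hcover, hcost⟩ := exists_dual_of_packing_le_univ (I := s)
    (A := fun j i => A j i) (fun i => hc i i.2)
    (fun f hf hle => hθ f hf fun i hi => hle ⟨i, hi⟩)
  let l' : I → ℝ := Function.extend Subtype.val l 0
  have hl' (i : s) : l' i = l i := Subtype.val_injective.extend_apply l 0 i
  have hnonneg : 0 ≤ l' := Function.extend_nonneg hl le_rfl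
  refine ⟨l', hnonneg, fun j => ?_, ?_⟩
  · rw [← Finset.sum_coe_sort s fun i => A j i * l' i]
    simpa only [hl'] using hcover j
  · rw [← Finset.sum_coe_sort s fun i => c i * l' i]
    simpa only [hl'] using hcost

lemma isCompact_packing [Fintype J] {s : Set I} {A : J → I → ℝ} (c : I → ℝ)
    (hA : ∀ j i, 0 ≤ A j i) (hpos : ∀ j, ∃ i ∈ s, 0 < A j i) :
    IsCompact {f : J → ℝ | (∀ j, 0 ≤ f j) ∧ ∀ i ∈ s, ∑ j, f j * A j i ≤ c i} := by
  choose i hi hAi using hpos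
  refine (isCompact_univ_pi fun j : J =>
    isCompact_Icc (a := (0 : ℝ)) (b := c (i j) / A j (i j))).of_isClosed_subset ?_ ?_
  · simp only [Set.ofPred_and, Set.ofPred_forall]
    exact (isClosed_iInter fun j => isClosed_le (by fun_prop) (by fun_prop)).inter
      (isClosed_biInter fun i _ => isClosed_le (by fun_prop) (by fun_prop))
  · rintro f ⟨hf, hle⟩ j -
    have hsingle : f j * A j (i j) ≤ ∑ j', f j' * A j' (i j) :=
      Finset.single_le_sum (f := fun j' => f j' * A j' (i j))
        (fun j' _ => mul_nonneg (hf j') (hA j' _)) (Finset.mem_univ j)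
    exact ⟨hf j, (le_div_iff₀ (hAi j)).2 (hsingle.trans (hle _ (hi j)))⟩

end LinearProgramming

section Walks

variable {α β : Type*} {G : Graph α β} {u v w : α} {es fs : List β}

lemma IsWalk.left_mem (h : IsWalk G u es v) : u ∈ V(G) := by
  cases h with
  | nil hx => exact hx
  | cons he _ => exact he.left_mem

lemma IsWalk.append (h : IsWalk G u es v) (h' : IsWalk G v fs w) : IsWalk G u (es ++ fs) w := by
  induction h with
  | nil _ => exact h'
  | cons he _ ih => exact .cons he (ih h')

lemma IsWalk.reverse (h : IsWalk G u es v) : IsWalk G v es.reverse u := by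
  induction h with
  | nil hx => exact .nil hx
  | cons he _ ih =>
    rw [List.reverse_cons]
    exact ih.append (.cons he.symm (.nil he.left_mem))

lemma IsWalk.exists_of_append (h : IsWalk G u (es ++ fs) v) :
    ∃ w, IsWalk G u es w ∧ IsWalk G w fs v := by
  induction es generalizing u with
  | nil => exact ⟨u, .nil h.left_mem, h⟩
  | cons e es ih =>
    cases h with
    | cons he hes =>
      obtain ⟨w, hw, hw'⟩ := ih hes
      exact ⟨w, .cons he hw, hw'⟩

lemma IsWalk.mem_edgeSet (h : IsWalk G u es v) : ∀ e ∈ es, e ∈ E(G) := by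
  induction h with
  | nil _ => simp
  | cons he _ ih => simpa using ⟨he.edge_mem, ih⟩

lemma IsWalk.ne_nil (h : IsWalk G u es v) (huv : u ≠ v) : es ≠ [] := by
  cases h with
  | nil _ => exact absurd rfl huv
  | cons _ _ => simp

lemma IsWalk.exists_sublist_nodup (h : IsWalk G u es v) :
    ∃ fs, fs.Sublist es ∧ fs.Nodup ∧ IsWalk G u fs v := by
  induction h with
  | nil hx => exact ⟨[], List.Sublist.refl _, List.nodup_nil, .nil hx⟩
  | @cons x y z e es he _ ih =>
    obtain ⟨fs, hsub, hnodup, hfs⟩ := ih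
    by_cases hmem : e ∈ fs
    · obtain ⟨l₁, l₂, rfl⟩ := List.append_of_mem hmem
      have hsuffix : (e :: l₂).Sublist (e :: es) :=
        ((List.sublist_append_right l₁ _).trans hsub).cons e
      have hnodup' : (e :: l₂).Nodup := hnodup.of_append_right
      obtain ⟨p, -, hp⟩ := hfs.exists_of_append
      cases hp with
      | cons he' hl₂ =>
        rcases he.eq_and_eq_or_eq_and_eq he' with ⟨rfl, rfl⟩ | ⟨rfl, rfl⟩
        · exact ⟨e :: l₂, hsuffix, hnodup', .cons he' hl₂⟩
        · exact ⟨l₂, (List.sublist_cons_self e l₂).trans hsuffix, hnodup'.of_cons, hl₂⟩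
    · exact ⟨e :: fs, hsub.cons_cons e, List.nodup_cons.2 ⟨hmem, hnodup⟩, .cons he hfs⟩

lemma IsWalk.two_mul_dist_le (h : IsWalk G u es v) (d : PseudoMetric α ℕ) :
    2 * d u v ≤ (es.map (edgeSum G d)).sum := by
  induction h with
  | nil _ => simp [d.refl]
  | @cons x y z e es he _ ih =>
    rw [List.map_cons, List.sum_cons, edgeSum_pseudoMetric d he]
    have := d.triangle x y z
    omega

/-- The least length of a walk of `G` from `v` to `t` with respect to the edge lengths `L`, capped
at `M`; the cap also serves the nodes that are not connected to `t`. -/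
def walkDist (G : Graph α β) (L : β → ℝ) (M : ℝ) (v t : α) : ℝ :=
  sInf (insert M {r | ∃ es, IsWalk G v es t ∧ (es.map L).sum = r})

variable {L : β → ℝ} {M D : ℝ} {s t : α}

lemma le_walkDist (hM : D ≤ M) (h : ∀ es, IsWalk G v es t → D ≤ (es.map L).sum) :
    D ≤ walkDist G L M v t := by
  refine le_csInf (Set.insert_nonempty _ _) ?_
  rintro _ (rfl | ⟨es, hes, rfl⟩)
  exacts [hM, h es hes]

lemma bddBelow_walk_lengths (hL : ∀ e, 0 ≤ L e) (M : ℝ) (v t : α) :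
    BddBelow (insert M {r | ∃ es, IsWalk G v es t ∧ (es.map L).sum = r}) := by
  refine BddBelow.insert M ⟨0, ?_⟩
  rintro _ ⟨es, -, rfl⟩
  exact List.sum_nonneg (by simpa using fun e _ => hL e)

lemma walkDist_le_cap (hL : ∀ e, 0 ≤ L e) (M : ℝ) (v t : α) : walkDist G L M v t ≤ M :=
  csInf_le (bddBelow_walk_lengths hL M v t) (Set.mem_insert _ _)

lemma IsWalk.walkDist_le (h : IsWalk G v es t) (hL : ∀ e, 0 ≤ L e) (M : ℝ) :
    walkDist G L M v t ≤ (es.map L).sum :=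
  csInf_le (bddBelow_walk_lengths hL M v t) (Or.inr ⟨es, h, rfl⟩)

lemma walkDist_nonneg (hL : ∀ e, 0 ≤ L e) (hM : 0 ≤ M) (v t : α) : 0 ≤ walkDist G L M v t :=
  le_walkDist hM fun _ _ => List.sum_nonneg (by simpa using fun e _ => hL e)

lemma walkDist_self (hL : ∀ e, 0 ≤ L e) (hM : 0 ≤ M) (hv : v ∈ V(G)) :
    walkDist G L M v v = 0 :=
  le_antisymm (by simpa using (IsWalk.nil hv).walkDist_le hL M) (walkDist_nonneg hL hM v v)

lemma walkDist_le_add_walkDist (hL : ∀ e, 0 ≤ L e) {e : β} (he : G.IsLink e u v) :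
    walkDist G L M u t ≤ L e + walkDist G L M v t := by
  rw [← sub_le_iff_le_add']
  refine le_walkDist ((sub_le_self _ (hL e)).trans (walkDist_le_cap hL M u t)) fun es hes => ?_
  rw [sub_le_iff_le_add']
  simpa using (IsWalk.cons he hes).walkDist_le hL M

lemma le_walkDist_add_walkDist (hL : ∀ e, 0 ≤ L e) (hM : 0 ≤ M) (hDM : D ≤ M)
    (h : ∀ es, IsWalk G s es t → D ≤ (es.map L).sum) (v : α) :
    D ≤ walkDist G L M v s + walkDist G L M v t := by
  rw [← sub_le_iff_le_add]
  refine le_walkDist (by linarith [walkDist_nonneg (G := G) hL hM v t]) fun es hes => ?_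
  rw [sub_le_comm]
  have hes_nonneg : 0 ≤ (es.map L).sum := List.sum_nonneg (by simpa using fun e _ => hL e)
  refine le_walkDist (by linarith) fun fs hfs => ?_
  have := h _ (hes.reverse.append hfs)
  rw [List.map_append, List.sum_append, List.map_reverse, List.sum_reverse] at this
  linarith

end Walks

section Flow

variable {α β : Type*} {G : Graph α β} {T : Set α}

lemma TPath.sum_traversals_mul {V : Finset α} (hV : V = V(G)) (P : TPath G T) (g : α → α → ℝ) :
    ∑ x ∈ V, ∑ y ∈ V, (P.traversals x y : ℝ) * g x y = (P.edges.map (edgeSum G g)).sum := by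
  classical
  rw [← List.sum_toFinset _ P.nodup, sum_edgeSum_eq_sum_card_mul hV]
  simp only [TPath.traversals, List.mem_toFinset]

lemma IsFractionalFlow.sum_mul_length_le (hV : V(G).Finite) (hE : E(G).Finite)
    {f : TPath G T →₀ ℝ} (hf : IsFractionalFlow G T f) {g : α → α → ℝ} (hg : ∀ x y, 0 ≤ g x y) :
    (f.sum fun P w => w * (P.edges.map (edgeSum G g)).sum) ≤ graphSum G g := by
  have hmem {x : α} : x ∈ hV.toFinset → x ∈ V(G) := hV.mem_toFinset.1
  calc f.sum (fun P w => w * (P.edges.map (edgeSum G g)).sum)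
      = ∑ x ∈ hV.toFinset, ∑ y ∈ hV.toFinset,
          (f.sum fun P w => w * (P.traversals x y : ℝ)) * g x y := by
        simp only [← TPath.sum_traversals_mul hV.coe_toFinset, Finsupp.sum, Finset.mul_sum,
          Finset.sum_mul, ← mul_assoc]
        rw [Finset.sum_comm]
        exact Finset.sum_congr rfl fun x _ => Finset.sum_comm
    _ ≤ ∑ x ∈ hV.toFinset, ∑ y ∈ hV.toFinset, (edgeCount G x y : ℝ) * g x y := by
        gcongr with x hx y hy
        · exact hg x y
        · exact hf.capacity x (hmem hx) y (hmem hy)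
    _ = graphSum G g := (graphSum_eq_sum_edgeCount_mul hV.coe_toFinset hE g).symm

lemma TPath.traversals_le_edgeCount (hE : E(G).Finite) (P : TPath G T) (x y : α) :
    P.traversals x y ≤ edgeCount G x y :=
  Set.ncard_le_ncard (fun _ h => h.2) (hE.subset fun _ h => h.edge_mem)

lemma isFractionalFlow_of_le_max_one (hE : E(G).Finite) {f : TPath G T →₀ ℝ} (hf : ∀ P, 0 ≤ f P)
    (hcapacity : ∀ x ∈ V(G), ∀ y ∈ V(G),
      (f.sum fun P w => w * (P.traversals x y : ℝ)) ≤ max 1 (edgeCount G x y : ℝ)) :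
    IsFractionalFlow G T f := by
  refine ⟨hf, fun x hx y hy => ?_⟩
  rcases Nat.eq_zero_or_pos (edgeCount G x y) with hzero | hpos
  · have htraversals (P : TPath G T) : P.traversals x y = 0 :=
      Nat.le_zero.1 (hzero ▸ P.traversals_le_edgeCount hE x y)
    simp [htraversals, hzero]
  · have hmax := hcapacity x hx y hy
    rwa [max_eq_right (by exact_mod_cast hpos)] at hmax

lemma exists_edgeLength (hV : V(G).Finite) (hE : E(G).Finite) {r : TPath G T → ℝ} {θ : ℝ}
    (hθ : ∀ f : TPath G T →₀ ℝ, IsFractionalFlow G T f → (f.sum fun P w => r P * w) ≤ θ) :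
    ∃ L : β → ℝ, (∀ e, 0 ≤ L e) ∧ (∀ P : TPath G T, r P ≤ (P.edges.map L).sum) ∧
      ∑ᶠ e ∈ E(G), L e ≤ θ := by
  set V := hV.toFinset
  have hmem {x : α} : x ∈ V(G) → x ∈ V := hV.mem_toFinset.2
  obtain ⟨l, hl, hcover, hcost⟩ := exists_dual_of_packing_le (s := V ×ˢ V) (b := r) (θ := θ)
    (A := fun P z => (P.traversals z.1 z.2 : ℝ)) (c := fun z => max 1 (edgeCount G z.1 z.2 : ℝ))
    (fun z _ => lt_max_of_lt_left one_pos) fun f hf hcapacity => by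
      simp only [mul_comm _ (r _)]
      exact hθ f <| isFractionalFlow_of_le_max_one hE hf fun x hx y hy =>
        hcapacity (x, y) (Finset.mk_mem_product (hmem hx) (hmem hy))
  simp only [Finset.sum_product] at hcover hcost
  let g (x y : α) : ℝ := l (x, y)
  have hg (x y : α) : 0 ≤ g x y := hl (x, y)
  refine ⟨edgeSum G g, edgeSum_nonneg hg, fun P => ?_, ?_⟩
  · rw [← P.sum_traversals_mul hV.coe_toFinset]
    exact hcover P
  · refine (graphSum_eq_sum_edgeCount_mul hV.coe_toFinset hE g).trans_le (le_trans ?_ hcost)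
    gcongr with x _ y _
    · exact hg x y
    · exact le_max_right _ _

lemma finite_tPath [Finite T] (hE : E(G).Finite) : Finite (TPath G T) := by
  classical
  have := hE.fintype
  let encode (P : TPath G T) : T × T × {l : List E(G) // l.Nodup} :=
    (P.source, P.target, ⟨P.edges.attachWith _ P.isWalk.mem_edgeSet,
      List.Nodup.of_map Subtype.val (by simpa using P.nodup)⟩)
  refine Finite.of_injective encode fun P Q h => ?_
  simp only [encode, Prod.mk.injEq, Subtype.mk.injEq] at h
  obtain ⟨hsource, htarget, hattach⟩ := h
  have hedges := congrArg (List.map Subtype.val) hattach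
  simp only [List.attachWith_map_subtype_val] at hedges
  cases P
  cases Q
  simp only at hsource htarget hedges
  subst hsource htarget hedges
  rfl

lemma TPath.exists_traversals_pos (P : TPath G T) :
    ∃ x ∈ V(G), ∃ y ∈ V(G), 0 < P.traversals x y := by
  obtain ⟨e, he⟩ := List.exists_mem_of_ne_nil _
    (P.isWalk.ne_nil (Subtype.coe_injective.ne P.unclosed))
  obtain ⟨x, y, hxy⟩ := G.exists_isLink_of_mem_edgeSet (P.isWalk.mem_edgeSet e he)
  refine ⟨x, hxy.left_mem, y, hxy.right_mem, ?_⟩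
  have hfinite : {e | e ∈ P.edges ∧ G.IsLink e x y}.Finite :=
    (List.finite_toSet P.edges).subset fun _ h => h.1
  exact (Set.ncard_pos hfinite).2 ⟨e, he, hxy⟩

lemma isGreatest_theta [Finite T] (hE : E(G).Finite) (S : SimpleGraph T) :
    IsGreatest (weakValues G T S) (theta G T S) := by
  have := finite_tPath (T := T) hE
  have := Fintype.ofFinite (TPath G T)
  let C : Set (TPath G T → ℝ) := {g | (∀ P, 0 ≤ g P) ∧ ∀ z ∈ V(G) ×ˢ V(G),
    ∑ P, g P * (P.traversals z.1 z.2 : ℝ) ≤ edgeCount G z.1 z.2}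
  have hcompact : IsCompact C := by
    refine isCompact_packing _ (fun P z => Nat.cast_nonneg _) fun P => ?_
    obtain ⟨x, hx, y, hy, hxy⟩ := P.exists_traversals_pos
    exact ⟨(x, y), ⟨hx, hy⟩, Nat.cast_pos.2 hxy⟩
  have hflow (f : TPath G T →₀ ℝ) : IsFractionalFlow G T f ↔ ⇑f ∈ C := by
    have hsum (x y : α) : (f.sum fun P w => w * (P.traversals x y : ℝ)) =
        ∑ P, f P * (P.traversals x y : ℝ) := Finsupp.sum_fintype _ _ (by simp)
    refine ⟨fun h => ⟨h.nonneg, fun z hz => ?_⟩, fun h => ⟨h.1, fun x hx y hy => ?_⟩⟩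
    · exact hsum z.1 z.2 ▸ h.capacity z.1 hz.1 z.2 hz.2
    · exact hsum x y ▸ h.2 (x, y) ⟨hx, hy⟩
  have hvalues : weakValues G T S =
      (fun g : TPath G T → ℝ => ∑ P, weakReward S P.source P.target * g P) '' C := by
    have hsum (f : TPath G T →₀ ℝ) : weakValue S f =
        ∑ P, weakReward S P.source P.target * f P := Finsupp.sum_fintype _ _ (by simp)
    ext r
    simp only [weakValues, Set.mem_ofPred_eq, Set.mem_image, hflow, hsum]
    exact Finsupp.equivFunOnFinite.exists_congr fun f => Iff.rfl
  rw [theta, hvalues]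
  refine (hcompact.image (by fun_prop)).isGreatest_sSup (Set.Nonempty.image _ ⟨0, ?_⟩)
  simp [C]

end Flow

section RandomThreshold

open MeasureTheory Set

/-- The indicator function of the thresholds that separate `x` from `z`. -/
def gap (x z r : ℝ) : ℝ := (uIoc x z).indicator 1 r

lemma gap_eq (x z r : ℝ) :
    gap x z r = |(if r ≤ x then 1 else 0) - (if r ≤ z then 1 else 0)| := by
  unfold gap indicator
  simp only [mem_uIoc, Pi.one_apply]
  by_cases hx : r ≤ x <;> by_cases hz : r ≤ z <;> simp [hx, hz, not_lt]

/-- The mean of `f r` over a uniformly distributed threshold `r` in `(0, 1]` is at most `δ`. The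
majorant `g` spares a proof that `f` is measurable. -/
def HasMeanLE (f : ℝ → ℝ) (δ : ℝ) : Prop :=
  ∃ g : ℝ → ℝ, IntegrableOn g (Ioc 0 1) ∧ ∫ r in Ioc (0 : ℝ) 1, g r ≤ δ ∧
    ∀ r ∈ Ioc (0 : ℝ) 1, f r ≤ g r

lemma hasMeanLE_gap {x z : ℝ} (hx : x ∈ Icc (0 : ℝ) 1) (hz : z ∈ Icc (0 : ℝ) 1) :
    HasMeanLE (gap x z) |x - z| := by
  have hsubset : uIoc x z ⊆ Ioc 0 1 := Ioc_subset_Ioc (le_min hx.1 hz.1) (max_le hx.2 hz.2)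
  refine ⟨gap x z, (integrable_const (1 : ℝ)).indicator measurableSet_uIoc, ?_, fun r _ => le_rfl⟩
  unfold gap
  rw [setIntegral_indicator measurableSet_uIoc, inter_eq_right.2 hsubset]
  simp [uIoc, max_sub_min_eq_abs']

lemma HasMeanLE.mono {f f' : ℝ → ℝ} {δ δ' : ℝ} (h : HasMeanLE f δ)
    (hf : ∀ r ∈ Ioc (0 : ℝ) 1, f' r ≤ f r) (hδ : δ ≤ δ') : HasMeanLE f' δ' := by
  obtain ⟨g, hg, hint, hle⟩ := h
  exact ⟨g, hg, hint.trans hδ, fun r hr => (hf r hr).trans (hle r hr)⟩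

lemma HasMeanLE.add {f f' : ℝ → ℝ} {δ δ' : ℝ} (h : HasMeanLE f δ) (h' : HasMeanLE f' δ') :
    HasMeanLE (fun r => f r + f' r) (δ + δ') := by
  obtain ⟨g, hg, hint, hle⟩ := h
  obtain ⟨g', hg', hint', hle'⟩ := h'
  refine ⟨g + g', hg.add hg', ?_, fun r hr => add_le_add (hle r hr) (hle' r hr)⟩
  rw [integral_add' hg hg']
  exact add_le_add hint hint'

lemma hasMeanLE_sum {ι : Type*} {s : Finset ι} {f : ι → ℝ → ℝ} {δ : ι → ℝ}
    (h : ∀ i ∈ s, HasMeanLE (f i) (δ i)) :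
    HasMeanLE (fun r => ∑ i ∈ s, f i r) (∑ i ∈ s, δ i) := by
  choose! g hg hint hle using h
  refine ⟨fun r => ∑ i ∈ s, g i r, integrable_finsetSum _ hg, ?_,
    fun r hr => Finset.sum_le_sum fun i hi => hle i hi r hr⟩
  rw [integral_finsetSum _ hg]
  exact Finset.sum_le_sum hint

lemma HasMeanLE.exists_le {f : ℝ → ℝ} {δ : ℝ} (h : HasMeanLE f δ) :
    ∃ r ∈ Ioc (0 : ℝ) 1, f r ≤ δ := by
  obtain ⟨g, hg, hint, hle⟩ := h
  obtain ⟨r, hr, hmean⟩ := exists_le_setAverage (μ := volume) (s := Ioc (0 : ℝ) 1) (by simp)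
    (by simp) hg
  rw [setAverage_eq] at hmean
  exact ⟨r, hr, (hle r hr).trans (hmean.trans (by simpa using hint))⟩

end RandomThreshold

section Folder

variable {ι : Type*} {S : SimpleGraph ι}

/-- A point of the folder complex, in which the center, a line and a terminal on it span a
triangle. A point is given by the triangle that contains it and by its affinities, that is, `2`
minus its distances: `top` to the terminal `apex`, `second` to the other terminals on `line`. -/
structure FolderPoint (S : SimpleGraph ι) where
  apex : ι
  line : anticliques S
  apex_mem : apex ∈ line.1
  top : ℝ
  second : ℝ
  second_nonneg : 0 ≤ second
  second_le_top : second ≤ top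
  top_add_second_le : top + second ≤ 2

namespace FolderPoint

open Classical in
/-- The affinity of the point to the terminals of `B` other than `apex`, extended to negative values
if `B` is not the line of the point. -/
def secondAlong (P : FolderPoint S) (B : anticliques S) : ℝ :=
  if P.line = B then P.second else -P.second

/-- The threshold below which the point is rounded to a vertex of the edge from `B` to `apex`, if
`B` is the line of the point; the two cuts change roles on the other lines through `apex`. -/
def alongCut (P : FolderPoint S) (B : anticliques S) : ℝ := (P.top + P.secondAlong B) / 2

/-- The threshold below which the point is rounded to `apex`, if `B` is the line of the point. -/
def acrossCut (P : FolderPoint S) (B : anticliques S) : ℝ := (P.top - P.secondAlong B) / 2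

/-- The vertex of its triangle to which the point is rounded at the threshold `r`. -/
def round (P : FolderPoint S) (r : ℝ) : FrameVertex S :=
  if r ≤ P.acrossCut P.line then .terminal P.apex
  else if r ≤ P.alongCut P.line then .line P.line
  else .center

variable {P Q : FolderPoint S} {B : anticliques S} {r : ℝ}

lemma secondAlong_line (P : FolderPoint S) : P.secondAlong P.line = P.second := if_pos rfl

lemma secondAlong_of_ne (h : P.line ≠ B) : P.secondAlong B = -P.second := if_neg h

lemma alongCut_of_ne (h : P.line ≠ B) : P.alongCut B = P.acrossCut P.line := by
  rw [alongCut, acrossCut, secondAlong_of_ne h, secondAlong_line, sub_eq_add_neg]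

lemma acrossCut_of_ne (h : P.line ≠ B) : P.acrossCut B = P.alongCut P.line := by
  rw [alongCut, acrossCut, secondAlong_of_ne h, secondAlong_line, sub_neg_eq_add]

lemma abs_secondAlong (P : FolderPoint S) (B : anticliques S) : |P.secondAlong B| = P.second := by
  unfold secondAlong
  split_ifs <;> simp [abs_of_nonneg P.second_nonneg]

lemma alongCut_mem_Icc (P : FolderPoint S) (B : anticliques S) :
    P.alongCut B ∈ Set.Icc (0 : ℝ) 1 := by
  have habs := abs_le.1 (P.abs_secondAlong B).le
  have := P.second_le_top
  have := P.top_add_second_le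
  constructor <;> unfold alongCut <;> linarith

lemma acrossCut_mem_Icc (P : FolderPoint S) (B : anticliques S) :
    P.acrossCut B ∈ Set.Icc (0 : ℝ) 1 := by
  have habs := abs_le.1 (P.abs_secondAlong B).le
  have := P.second_le_top
  have := P.top_add_second_le
  constructor <;> unfold acrossCut <;> linarith

lemma acrossCut_le_alongCut (P : FolderPoint S) : P.acrossCut P.line ≤ P.alongCut P.line := by
  rw [alongCut, acrossCut, secondAlong_line]
  linarith [P.second_nonneg]

lemma round_cases (P : FolderPoint S) (r : ℝ) :
    (r ≤ P.acrossCut P.line ∧ r ≤ P.alongCut P.line ∧ P.round r = .terminal P.apex) ∨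
    (¬ r ≤ P.acrossCut P.line ∧ r ≤ P.alongCut P.line ∧ P.round r = .line P.line) ∨
    (¬ r ≤ P.acrossCut P.line ∧ ¬ r ≤ P.alongCut P.line ∧ P.round r = .center) := by
  unfold round
  by_cases hacross : r ≤ P.acrossCut P.line
  · simp [hacross, hacross.trans P.acrossCut_le_alongCut]
  · by_cases halong : r ≤ P.alongCut P.line <;> simp [hacross, halong]

lemma frameDist_round_le_of_classDist_eq_zero [Finite ι] (hK : IsKClutter (anticliques S))
    (hPQ : classDist S P.apex Q.apex = 0) (r : ℝ) :
    (frameDist (P.round r) (Q.round r) : ℝ) ≤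
      gap (P.alongCut P.line) (Q.alongCut P.line) r +
        gap (P.acrossCut P.line) (Q.acrossCut P.line) r := by
  have hP : P.apex ∈ Q.line.1 :=
    mem_of_classDist_eq_zero hK ((classDist_comm _ _).trans hPQ) Q.line.2 Q.apex_mem
  have hQ : Q.apex ∈ P.line.1 := mem_of_classDist_eq_zero hK hPQ P.line.2 P.apex_mem
  by_cases hline : Q.line = P.line
  · rw [hline] at hP
    rcases P.round_cases r with h | h | h <;> rcases Q.round_cases r with h' | h' | h' <;>
      rw [hline] at h' <;> simp [h, h', gap_eq, frameDist, hP, hQ, hPQ] <;> norm_num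
  · rw [alongCut_of_ne hline, acrossCut_of_ne hline]
    rcases P.round_cases r with h | h | h <;> rcases Q.round_cases r with h' | h' | h' <;>
      simp [h, h', gap_eq, frameDist, hP, hQ, hPQ, Ne.symm hline] <;> norm_num

lemma round_cases_along (P : FolderPoint S) (B : anticliques S) (r : ℝ) :
    (r ≤ P.acrossCut B ∧ r ≤ P.alongCut B ∧ P.round r = .terminal P.apex) ∨
    (¬ r ≤ P.acrossCut B ∧ r ≤ P.alongCut B ∧ P.round r = .line B) ∨
    (r ≤ P.acrossCut B ∧ ¬ r ≤ P.alongCut B ∧ ∃ A, P.round r = .line A) ∨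
    (¬ r ≤ P.acrossCut B ∧ ¬ r ≤ P.alongCut B ∧ P.round r = .center) := by
  by_cases hline : P.line = B
  · subst hline
    rcases P.round_cases r with h | h | h <;> simp [h]
  · rw [alongCut_of_ne hline, acrossCut_of_ne hline]
    rcases P.round_cases r with h | h | h <;> simp [h]

lemma frameDist_round_le_of_mem (hr : 0 < r) (hP : P.apex ∈ B.1) (hQ : Q.apex ∈ B.1) :
    (frameDist (P.round r) (Q.round r) : ℝ) ≤
      gap (P.alongCut B) (Q.alongCut B) r + gap (P.acrossCut B) 0 r + gap (Q.acrossCut B) 0 r := by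
  have hPQ : classDist S P.apex Q.apex ≤ 2 := classDist_le_two B.2 hP hQ
  rcases P.round_cases_along B r with h | h | ⟨hacross, halong, A, hround⟩ | h <;>
    rcases Q.round_cases_along B r with h' | h' | ⟨hacross', halong', A', hround'⟩ | h' <;>
    simp only [*, gap_eq, frameDist] <;> split_ifs <;> norm_num <;> grind

lemma frameDist_round_le (hr : 0 < r) :
    (frameDist (P.round r) (Q.round r) : ℝ) ≤
      gap (P.alongCut P.line) 0 r + gap (P.acrossCut P.line) 0 r +
        (gap (Q.alongCut Q.line) 0 r + gap (Q.acrossCut Q.line) 0 r) := by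
  have hPQ : classDist S P.apex Q.apex ≤ 4 := classDist_le_four _ _
  rcases P.round_cases r with h | h | h <;> rcases Q.round_cases r with h' | h' | h' <;>
    simp only [h, h', gap_eq, frameDist] <;> split_ifs <;> norm_num <;> grind

end FolderPoint

end Folder

section Rounding

variable {ι : Type*} {S : SimpleGraph ι}

/-- The point of the folder complex with the affinities `a` to the terminals, where negative
affinities count as `0`. -/
structure FolderPoint.Represents (P : FolderPoint S) (a : ι → ℝ) : Prop where
  le_top : ∀ t, a t ≤ P.top
  top_eq : P.top = 0 ∨ P.top = a P.apex
  le_second : ∀ t, classDist S P.apex t ≠ 0 → a t ≤ P.second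
  second_eq : P.second = 0 ∨ ∃ t ∈ P.line.1, classDist S P.apex t ≠ 0 ∧ P.second = a t

section Existence

variable [Finite ι] {a : ι → ℝ} (ha : ∀ s t, a s + a t ≤ 4 - classDist S s t) {s : ι}
  (hs : ∀ t, a t ≤ a s)

include ha hs in
lemma exists_represents_of_pos (hpos : ∃ t, classDist S s t ≠ 0 ∧ 0 < a t) :
    ∃ P : FolderPoint S, P.Represents a := by
  obtain ⟨t, ⟨hst, ht⟩, hmax⟩ :=
    (Set.toFinite {t | classDist S s t ≠ 0 ∧ 0 < a t}).exists_maximalFor a _ hpos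
  have hle (u : ι) (hu : classDist S s u ≠ 0) : a u ≤ a t :=
    (le_total (a u) (a t)).elim id fun h => hmax ⟨hu, ht.trans_le h⟩ h
  have hlt : classDist S s t < 4 := by
    have : (classDist S s t : ℝ) < 4 := by linarith [ha s t, hs t]
    exact_mod_cast this
  have htwo : classDist S s t = 2 := by
    have := classDist_cases (S := S) s t
    omega
  have hsum : a s + a t ≤ 2 := (ha s t).trans_eq (by rw [htwo]; norm_num)
  obtain ⟨A, hA, hsA, htA⟩ := exists_anticlique_of_classDist_lt hlt
  exact ⟨⟨s, ⟨A, hA⟩, hsA, a s, a t, ht.le, hs t, hsum⟩, hs, .inr rfl, hle, .inr ⟨t, htA, hst, rfl⟩⟩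

include ha hs in
lemma exists_represents_of_nonpos (hnonpos : ∀ t, classDist S s t ≠ 0 → a t ≤ 0) :
    ∃ P : FolderPoint S, P.Represents a := by
  obtain ⟨A, hA, hsA, -⟩ := exists_anticlique_of_not_adj (S.loopless.irrefl s)
  have hle : max 0 (a s) + 0 ≤ 2 := by
    have := ha s s
    rw [classDist_self, Nat.cast_zero] at this
    rw [add_zero]
    exact max_le zero_le_two (by linarith)
  exact ⟨⟨s, ⟨A, hA⟩, hsA, max 0 (a s), 0, le_rfl, le_max_left _ _, hle⟩,
    fun t => (hs t).trans (le_max_right _ _), max_choice _ _, hnonpos, .inl rfl⟩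

include ha in
lemma exists_represents [Nonempty ι] : ∃ P : FolderPoint S, P.Represents a := by
  obtain ⟨s, hs⟩ := Finite.exists_max a
  by_cases hpos : ∃ t, classDist S s t ≠ 0 ∧ 0 < a t
  · exact exists_represents_of_pos ha hs hpos
  · push Not at hpos
    exact exists_represents_of_nonpos ha hs hpos

end Existence

/-- The inequalities between the affinities of two points of a metric space that contains the
terminals which follow from the triangle inequality if the distance of the points is at most `δ`. -/
structure IsNear (S : SimpleGraph ι) (a a' : ι → ℝ) (δ : ℝ) : Prop where
  le : ∀ t, a t ≤ a' t + δ
  ge : ∀ t, a' t ≤ a t + δ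
  add_le : ∀ s t, a s + a' t ≤ 4 - classDist S s t + δ

namespace IsNear

variable {a a' : ι → ℝ} {δ : ℝ}

lemma symm (h : IsNear S a a' δ) : IsNear S a' a δ where
  le := h.ge
  ge := h.le
  add_le s t := by
    have := h.add_le t s
    rw [classDist_comm] at this
    linarith

lemma nonneg [Nonempty ι] (h : IsNear S a a' δ) : 0 ≤ δ := by
  have t := Classical.arbitrary ι
  linarith [h.le t, h.ge t]

lemma add_le_of_classDist_eq_four (h : IsNear S a a' δ) {s t : ι} (hst : classDist S s t = 4) :
    a s + a' t ≤ δ := by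
  have := h.add_le s t
  rw [hst] at this
  norm_num at this
  exact this

variable {P Q : FolderPoint S} (h : IsNear S a a' δ) (hP : P.Represents a) (hQ : Q.Represents a')

include h hP hQ

lemma top_le : P.top ≤ Q.top + δ := by
  have : Nonempty ι := ⟨P.apex⟩
  rcases hP.top_eq with htop | htop
  · linarith [Q.second_nonneg, Q.second_le_top, h.nonneg]
  · linarith [h.le P.apex, hQ.le_top P.apex]

lemma top_le_second (hPQ : classDist S Q.apex P.apex ≠ 0) : P.top ≤ Q.second + δ := by
  have : Nonempty ι := ⟨P.apex⟩
  rcases hP.top_eq with htop | htop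
  · linarith [Q.second_nonneg, h.nonneg]
  · linarith [h.le P.apex, hQ.le_second P.apex hPQ]

lemma second_le [Finite ι] (hK : IsKClutter (anticliques S))
    (hPQ : classDist S P.apex Q.apex = 0) : P.second ≤ Q.second + δ := by
  have : Nonempty ι := ⟨P.apex⟩
  rcases hP.second_eq with hsecond | ⟨t, -, ht, hsecond⟩
  · linarith [Q.second_nonneg, h.nonneg]
  · have := classDist_le_of_classDist_eq_zero hK hPQ t
    linarith [h.le t, hQ.le_second t (by omega)]

lemma top_add_top_le (hPQ : classDist S P.apex Q.apex = 4) : P.top + Q.top ≤ δ := by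
  rcases hP.top_eq with htop | htop
  · linarith [h.symm.top_le hQ hP]
  rcases hQ.top_eq with htop' | htop'
  · linarith [h.top_le hP hQ]
  · linarith [h.add_le_of_classDist_eq_four hPQ]

lemma second_add_second_le [Finite ι] (hK : IsKClutter (anticliques S))
    (hPQ : classDist S P.apex Q.apex = 0) (hline : P.line ≠ Q.line) :
    P.second + Q.second ≤ δ := by
  have hQP := (classDist_comm Q.apex P.apex).trans hPQ
  rcases hP.second_eq with hsecond | ⟨s, hs, hPs, hsecond⟩
  · linarith [h.symm.second_le hQ hP hK hQP]
  rcases hQ.second_eq with hsecond' | ⟨t, ht, hQt, hsecond'⟩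
  · linarith [h.second_le hP hQ hK hPQ]
  · have hPt := classDist_le_of_classDist_eq_zero hK hQP t
    have hst : classDist S s t = 4 :=
      classDist_eq_four hK P.line.2 Q.line.2 (Subtype.coe_injective.ne hline) hs P.apex_mem
        (mem_of_classDist_eq_zero hK hQP Q.line.2 Q.apex_mem) ht (by rwa [classDist_comm])
        (by omega)
    linarith [h.add_le_of_classDist_eq_four hst]

lemma abs_second_sub_secondAlong_le [Finite ι] (hK : IsKClutter (anticliques S))
    (hPQ : classDist S P.apex Q.apex = 0) : |P.second - Q.secondAlong P.line| ≤ δ := by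
  by_cases hline : Q.line = P.line
  · rw [← hline, Q.secondAlong_line, abs_le]
    have := h.second_le hP hQ hK hPQ
    have := h.symm.second_le hQ hP hK ((classDist_comm _ _).trans hPQ)
    constructor <;> linarith
  · rw [FolderPoint.secondAlong_of_ne hline, sub_neg_eq_add,
      abs_of_nonneg (add_nonneg P.second_nonneg Q.second_nonneg)]
    exact h.second_add_second_le hP hQ hK hPQ (Ne.symm hline)

lemma top_le_secondAlong [Finite ι] (hK : IsKClutter (anticliques S)) {B : anticliques S}
    (hPB : P.apex ∈ B.1) (hQB : Q.apex ∈ B.1) (hPQ : classDist S P.apex Q.apex ≠ 0) :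
    P.top ≤ Q.secondAlong B + δ := by
  have htop_le := h.top_le_second hP hQ (by rwa [classDist_comm])
  by_cases hline : Q.line = B
  · rwa [← hline, Q.secondAlong_line]
  rw [FolderPoint.secondAlong_of_ne hline]
  rcases hQ.second_eq with hsecond | ⟨t, ht, hQt, hsecond⟩
  · linarith
  rcases hP.top_eq with htop | htop
  · linarith [h.ge t, hP.le_top t]
  · have hPt : classDist S P.apex t = 4 :=
      classDist_eq_four hK B.2 Q.line.2 (Subtype.coe_injective.ne (Ne.symm hline)) hPB hQB
        Q.apex_mem ht hPQ hQt
    linarith [h.add_le_of_classDist_eq_four hPt]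

lemma abs_alongCut_sub_add_abs_acrossCut_sub_le [Finite ι] (hK : IsKClutter (anticliques S))
    (hPQ : classDist S P.apex Q.apex = 0) :
    |P.alongCut P.line - Q.alongCut P.line| + |P.acrossCut P.line - Q.acrossCut P.line| ≤ δ := by
  have htop := h.top_le hP hQ
  have htop' := h.symm.top_le hQ hP
  have hsecond := abs_le.1 (h.abs_second_sub_secondAlong_le hP hQ hK hPQ)
  unfold FolderPoint.alongCut FolderPoint.acrossCut
  rw [P.secondAlong_line]
  rcases abs_cases ((P.top + P.second) / 2 - (Q.top + Q.secondAlong P.line) / 2) with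
    habs | habs <;>
  rcases abs_cases ((P.top - P.second) / 2 - (Q.top - Q.secondAlong P.line) / 2) with
    habs' | habs' <;>
  linarith

lemma abs_alongCut_sub_add_acrossCut_add_acrossCut_le [Finite ι]
    (hK : IsKClutter (anticliques S)) {B : anticliques S} (hPB : P.apex ∈ B.1)
    (hQB : Q.apex ∈ B.1) (hPQ : classDist S P.apex Q.apex ≠ 0) :
    |P.alongCut B - Q.alongCut B| + P.acrossCut B + Q.acrossCut B ≤ δ := by
  have htop := h.top_le_secondAlong hP hQ hK hPB hQB hPQ
  have htop' := h.symm.top_le_secondAlong hQ hP hK hQB hPB (by rwa [classDist_comm])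
  unfold FolderPoint.alongCut FolderPoint.acrossCut
  rcases abs_cases ((P.top + P.secondAlong B) / 2 - (Q.top + Q.secondAlong B) / 2) with
    habs | habs <;>
  linarith

end IsNear

namespace FolderPoint

variable {P Q : FolderPoint S} {a a' : ι → ℝ}

lemma hasMeanLE_gap_alongCut_zero (P : FolderPoint S) (B : anticliques S) :
    HasMeanLE (gap (P.alongCut B) 0) (P.alongCut B) := by
  have h := hasMeanLE_gap (P.alongCut_mem_Icc B) (z := 0) (by simp)
  rwa [sub_zero, abs_of_nonneg (P.alongCut_mem_Icc B).1] at h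

lemma hasMeanLE_gap_acrossCut_zero (P : FolderPoint S) (B : anticliques S) :
    HasMeanLE (gap (P.acrossCut B) 0) (P.acrossCut B) := by
  have h := hasMeanLE_gap (P.acrossCut_mem_Icc B) (z := 0) (by simp)
  rwa [sub_zero, abs_of_nonneg (P.acrossCut_mem_Icc B).1] at h

lemma alongCut_add_acrossCut (P : FolderPoint S) (B : anticliques S) :
    P.alongCut B + P.acrossCut B = P.top := by
  unfold alongCut acrossCut
  ring

lemma hasMeanLE_frameDist_round [Finite ι] (hK : IsKClutter (anticliques S)) {δ : ℝ}
    (h : IsNear S a a' δ) (hP : P.Represents a) (hQ : Q.Represents a') :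
    HasMeanLE (fun r => frameDist (P.round r) (Q.round r)) δ := by
  by_cases hzero : classDist S P.apex Q.apex = 0
  · exact ((hasMeanLE_gap (P.alongCut_mem_Icc _) (Q.alongCut_mem_Icc _)).add
      (hasMeanLE_gap (P.acrossCut_mem_Icc _) (Q.acrossCut_mem_Icc _))).mono
        (fun r _ => frameDist_round_le_of_classDist_eq_zero hK hzero r)
        (h.abs_alongCut_sub_add_abs_acrossCut_sub_le hP hQ hK hzero)
  by_cases hfour : classDist S P.apex Q.apex = 4
  · refine (((P.hasMeanLE_gap_alongCut_zero _).add (P.hasMeanLE_gap_acrossCut_zero _)).add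
      ((Q.hasMeanLE_gap_alongCut_zero _).add (Q.hasMeanLE_gap_acrossCut_zero _))).mono
        (fun r hr => frameDist_round_le hr.1) ?_
    rw [alongCut_add_acrossCut, alongCut_add_acrossCut]
    exact h.top_add_top_le hP hQ hfour
  · obtain ⟨B, hB, hPB, hQB⟩ :=
      exists_anticlique_of_classDist_lt (lt_of_le_of_ne (classDist_le_four _ _) hfour)
    exact (((hasMeanLE_gap (P.alongCut_mem_Icc ⟨B, hB⟩) (Q.alongCut_mem_Icc ⟨B, hB⟩)).add
      (P.hasMeanLE_gap_acrossCut_zero _)).add (Q.hasMeanLE_gap_acrossCut_zero _)).mono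
        (fun r hr => frameDist_round_le_of_mem hr.1 hPB hQB)
        (h.abs_alongCut_sub_add_acrossCut_add_acrossCut_le hP hQ hK hPB hQB hzero)

lemma Represents.round_of_eq_two (hP : P.Represents a) {t : ι} (ht : a t = 2) {r : ℝ}
    (hr : r ≤ 1) : P.round r = .terminal P.apex ∧ classDist S P.apex t = 0 := by
  have htop := hP.le_top t
  have hsum := P.top_add_second_le
  constructor
  · rw [round, if_pos]
    rw [acrossCut, secondAlong_line]
    linarith
  · by_contra hne
    linarith [hP.le_second t hne]

end FolderPoint

end Rounding

section FrameMap

variable {α β : Type*} {G : Graph α β} {T : Set α} {S : SimpleGraph T} {L : β → ℝ}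

/-- The affinities of the node `v` to the terminals for the edge lengths `L`. -/
def affinity (G : Graph α β) (L : β → ℝ) (v : α) (t : T) : ℝ := 2 - walkDist G L 4 v t

section Affinity

variable (hL : ∀ e, 0 ≤ L e)

include hL in
lemma affinity_self {t : T} (ht : t.1 ∈ V(G)) : affinity G L t.1 t = 2 := by
  rw [affinity, walkDist_self hL zero_le_four ht, sub_zero]

include hL in
lemma affinity_le_affinity_add {e : β} {x y : α} (he : G.IsLink e x y) (t : T) :
    affinity G L y t ≤ affinity G L x t + L e := by
  have := walkDist_le_add_walkDist (M := 4) (t := t.1) hL he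
  unfold affinity
  linarith

variable (hLS : ∀ P : TPath G T, (classDist S P.source P.target : ℝ) ≤ (P.edges.map L).sum)

include hL hLS in
lemma classDist_le_length {s t : T} {es : List β} (h : IsWalk G s es t) :
    (classDist S s t : ℝ) ≤ (es.map L).sum := by
  by_cases hst : s = t
  · rw [hst, classDist_self, Nat.cast_zero]
    exact List.sum_nonneg (by simpa using fun e _ => hL e)
  obtain ⟨fs, hsublist, hnodup, hfs⟩ := h.exists_sublist_nodup
  exact (hLS ⟨s, t, fs, hst, hfs, hnodup⟩).trans
    ((hsublist.map L).sum_le_sum (by simpa using fun e _ => hL e))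

include hL hLS in
lemma affinity_add_affinity_le (v : α) (s t : T) :
    affinity G L v s + affinity G L v t ≤ 4 - classDist S s t := by
  have := le_walkDist_add_walkDist hL zero_le_four (by exact_mod_cast classDist_le_four s t)
    (fun _ h => classDist_le_length hL hLS h) v
  unfold affinity
  linarith

include hL hLS in
lemma isNear_affinity {e : β} {x y : α} (he : G.IsLink e x y) :
    IsNear S (affinity G L x) (affinity G L y) (L e) where
  le t := affinity_le_affinity_add hL he.symm t
  ge t := affinity_le_affinity_add hL he t
  add_le s t := by
    have := affinity_add_affinity_le hL hLS x s t
    have := affinity_le_affinity_add hL he t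
    linarith

end Affinity

/-- A map of the nodes to the frame that fixes the terminals, up to distance `0`. -/
def IsFrameMap (S : SimpleGraph T) (φ : α → FrameVertex S) : Prop :=
  ∀ t : T, ∃ s, φ t = .terminal s ∧ classDist S s t = 0

lemma IsFrameMap.classDist_le [Finite T] (hK : IsKClutter (anticliques S))
    {φ : α → FrameVertex S} (hφ : IsFrameMap S φ) (s t : T) :
    classDist S s t ≤ frameMetric hK φ s t := by
  obtain ⟨s', hs', hss'⟩ := hφ s
  obtain ⟨t', ht', htt'⟩ := hφ t
  rw [frameMetric_apply, hs', ht', frameDist]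
  have := classDist_triangle hK s s' t
  have := classDist_triangle hK s' t' t
  rw [classDist_comm] at hss'
  omega

lemma exists_isFrameMap_graphSum_le [Finite T] (hK : IsKClutter (anticliques S))
    (hE : E(G).Finite) (hT : T ⊆ V(G)) (hL : ∀ e, 0 ≤ L e)
    (hLS : ∀ P : TPath G T, (classDist S P.source P.target : ℝ) ≤ (P.edges.map L).sum) :
    ∃ φ : α → FrameVertex S, IsFrameMap S φ ∧
      (graphSum G (frameMetric hK φ) : ℕ) ≤ 2 * ∑ᶠ e ∈ E(G), L e := by
  rcases isEmpty_or_nonempty T with hempty | hnonempty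
  · refine ⟨fun _ => .center, fun t => hempty.elim t, ?_⟩
    simpa [graphSum, edgeSum, frameMetric_apply, frameDist] using
      finsum_nonneg fun e => finsum_nonneg fun _ => hL e
  choose P hP using fun v => exists_represents (affinity_add_affinity_le hL hLS v)
  let φ (r : ℝ) (v : α) : FrameVertex S := (P v).round r
  have hedge : ∀ e ∈ hE.toFinset,
      HasMeanLE (fun r => (edgeSum G (frameMetric hK (φ r)) e : ℕ)) (2 * L e) := by
    intro e he
    obtain ⟨x, y, hxy⟩ := G.exists_isLink_of_mem_edgeSet (hE.mem_toFinset.1 he)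
    have h := FolderPoint.hasMeanLE_frameDist_round hK (isNear_affinity hL hLS hxy) (hP x) (hP y)
    simpa [φ, edgeSum_pseudoMetric _ hxy, frameMetric_apply, two_mul] using h.add h
  obtain ⟨r, hr, hle⟩ := (hasMeanLE_sum hedge).exists_le
  refine ⟨φ r, fun t => ⟨_, (hP t).round_of_eq_two (affinity_self hL (hT t.2)) hr.2⟩, ?_⟩
  rw [finsum_mem_eq_finite_toFinset_sum _ hE, graphSum_eq_sum hE.coe_toFinset, Finset.mul_sum]
  exact_mod_cast hle

lemma IsFractionalFlow.eight_mul_weakValue_le [Finite T] (hV : V(G).Finite) (hE : E(G).Finite)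
    (hK : IsKClutter (anticliques S)) {φ : α → FrameVertex S} (hφ : IsFrameMap S φ)
    {f : TPath G T →₀ ℝ} (hf : IsFractionalFlow G T f) :
    8 * weakValue S f ≤ graphSum G (frameMetric hK φ) := by
  set d := frameMetric hK φ
  have hreward (P : TPath G T) : 8 * weakReward S P.source P.target ≤
      (P.edges.map (edgeSum G fun x y => (d x y : ℝ))).sum := by
    have hlength : 2 * classDist S P.source P.target ≤ (P.edges.map (edgeSum G d)).sum :=
      (Nat.mul_le_mul_left 2 (hφ.classDist_le hK _ _)).trans (P.isWalk.two_mul_dist_le d)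
    have hcast : P.edges.map (edgeSum G fun x y => (d x y : ℝ)) =
        (P.edges.map (edgeSum G d)).map Nat.cast := by
      rw [List.map_map]
      exact List.map_congr_left fun e he => edgeSum_natCast d (P.isWalk.mem_edgeSet e he)
    calc 8 * weakReward S P.source P.target
        = (2 * classDist S P.source P.target : ℕ) := by
          push_cast
          rw [classDist_eq_four_mul_weakReward P.unclosed]
          ring
      _ ≤ ((P.edges.map (edgeSum G d)).sum : ℕ) := Nat.cast_le.2 hlength
      _ = _ := by rw [hcast, Nat.cast_list_sum]
  calc 8 * weakValue S f
      = f.sum fun P w => w * (8 * weakReward S P.source P.target) := by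
        rw [weakValue, Finsupp.mul_sum]
        exact Finsupp.sum_congr fun P _ => by ring
    _ ≤ f.sum fun P w => w * (P.edges.map (edgeSum G fun x y => (d x y : ℝ))).sum :=
        Finset.sum_le_sum fun P _ => mul_le_mul_of_nonneg_left (hreward P) (hf.nonneg P)
    _ ≤ graphSum G (fun x y => (d x y : ℝ)) :=
        hf.sum_mul_length_le hV hE fun x y => Nat.cast_nonneg _
    _ = graphSum G d := graphSum_natCast hV hE d

end FrameMap

section Network

variable {α β γ : Type*} {G : Graph α β} {G' : Graph α γ} {T : Set α} {S : SimpleGraph T}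

namespace IsKNetwork

variable (hN : IsKNetwork G T S)

include hN

lemma finite_terminals : Finite T := (hN.finite_vertexSet.subset hN.terminals_subset).to_subtype

lemma isGreatest_theta : IsGreatest (weakValues G T S) (theta G T S) :=
  have := hN.finite_terminals
  PathPacking.isGreatest_theta hN.finite_edgeSet S

lemma exists_eight_mul_theta_eq [Finite T] :
    ∃ φ : α → FrameVertex S, IsFrameMap S φ ∧
      8 * theta G T S = graphSum G (frameMetric hN.isKClutter φ) := by
  obtain ⟨⟨f, hf, hfθ⟩, hmax⟩ := hN.isGreatest_theta
  obtain ⟨L, hL, hcover, hcost⟩ := exists_edgeLength hN.finite_vertexSet hN.finite_edgeSet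
    (r := fun P : TPath G T => weakReward S P.source P.target) fun f hf => hmax ⟨f, hf, rfl⟩
  have hcover' (P : TPath G T) :
      (classDist S P.source P.target : ℝ) ≤ (P.edges.map fun e => 4 * L e).sum := by
    rw [classDist_eq_four_mul_weakReward P.unclosed, List.sum_map_mul_left]
    exact mul_le_mul_of_nonneg_left (hcover P) zero_le_four
  obtain ⟨φ, hφ, hle⟩ := exists_isFrameMap_graphSum_le hN.isKClutter hN.finite_edgeSet
    hN.terminals_subset (fun e => mul_nonneg zero_le_four (hL e)) hcover'
  refine ⟨φ, hφ, le_antisymm ?_ ?_⟩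
  · exact hfθ ▸ hf.eight_mul_weakValue_le hN.finite_vertexSet hN.finite_edgeSet hN.isKClutter hφ
  · rw [← mul_finsum_mem] at hle
    linarith

lemma four_dvd_graphSum [Finite T] {φ : α → FrameVertex S} (hφ : IsFrameMap S φ) :
    4 ∣ graphSum G (frameMetric hN.isKClutter φ) := by
  refine PathPacking.four_dvd_graphSum hN.finite_vertexSet hN.finite_edgeSet _
    (fun x => frameParity (φ x)) (fun x y => frameDist_modEq (φ x) (φ y)) fun x hx => ?_
  by_cases hxT : x ∈ T
  · obtain ⟨s, hs, -⟩ := hφ ⟨x, hxT⟩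
    simp [show φ x = .terminal s from hs, frameParity]
  · exact (hN.even_degree x ⟨hx, hxT⟩).mul_left _

lemma exists_two_mul_theta_eq : ∃ m : ℕ, 2 * theta G T S = m := by
  have := hN.finite_terminals
  obtain ⟨φ, hφ, heq⟩ := hN.exists_eight_mul_theta_eq
  obtain ⟨m, hm⟩ := hN.four_dvd_graphSum hφ
  refine ⟨m, ?_⟩
  rw [hm] at heq
  push_cast at heq
  linarith

variable {x : α} (hx : x ∈ V(G) \ T) (h : IsSplit G x G')

include hx h

lemma split : IsKNetwork G' T S where
  finite_vertexSet := h.1 ▸ hN.finite_vertexSet.sdiff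
  finite_edgeSet := h.2.1
  terminals_subset t ht := h.1 ▸ ⟨hN.terminals_subset ht, fun htx => hx.2 (htx ▸ ht)⟩
  even_degree y hy := by
    obtain ⟨hV', -, F, -, -, -, hdegree⟩ := h
    rw [hdegree y hy.1]
    exact hN.even_degree y ⟨(hV' ▸ hy.1 : y ∈ V(G) \ {x}).1, hy.2⟩
  isKClutter := hN.isKClutter

lemma theta_split_le : theta G' T S ≤ theta G T S := by
  have := hN.finite_terminals
  have hN' := hN.split hx h
  obtain ⟨φ, hφ, heq⟩ := hN.exists_eight_mul_theta_eq
  obtain ⟨f, hf, hfθ⟩ := hN'.isGreatest_theta.1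
  have hweak := hf.eight_mul_weakValue_le hN'.finite_vertexSet hN'.finite_edgeSet hN.isKClutter hφ
  have hsplit : ((graphSum G' (frameMetric hN.isKClutter φ) : ℕ) : ℝ) ≤
      (graphSum G (frameMetric hN.isKClutter φ) : ℕ) :=
    Nat.cast_le.2 (graphSum_split_le hN.finite_vertexSet hN.finite_edgeSet hx.1 h _)
  linarith

end IsKNetwork

end Network

end

end PathPacking

theorem mainTheorem4 {α β γ : Type*} (G : Graph α β) (T : Set α) (S : SimpleGraph T)
    (hN : PathPacking.IsKNetwork G T S) :
    IsGreatest (PathPacking.weakValues G T S) (PathPacking.theta G T S) ∧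
    (∃ m : ℕ, 2 * PathPacking.theta G T S = m) ∧
    ∀ x ∈ V(G) \ T, ∀ G' : Graph α γ, PathPacking.IsSplit G x G' →
      PathPacking.IsKNetwork G' T S ∧
      IsGreatest (PathPacking.weakValues G' T S) (PathPacking.theta G' T S) ∧
      ∃ k : ℕ, PathPacking.theta G' T S = PathPacking.theta G T S - (k : ℝ) / 2 := by
  refine ⟨hN.isGreatest_theta, hN.exists_two_mul_theta_eq, fun x hx G' h => ?_⟩
  have hN' := hN.split hx h
  refine ⟨hN', hN'.isGreatest_theta, ?_⟩
  obtain ⟨m, hm⟩ := hN.exists_two_mul_theta_eq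
  obtain ⟨n, hn⟩ := hN'.exists_two_mul_theta_eq
  have hnm : n ≤ m := by
    have : (n : ℝ) ≤ m := by linarith [hN.theta_split_le hx h]
    exact_mod_cast this
  refine ⟨m - n, ?_⟩
  rw [Nat.cast_sub hnm]
  linarith
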